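/- Let $l$ be a prime, let $k/k'$ be an extension of finite fields of degree $l$ and of characteristic different from $l$, and let $n\ge 2$. Write $\overline{\mathbb Z_l}$ for the integral closure of $\mathbb Z_l$ in an algebraic closure $\overline{\mathbb Q_l}$ of $\mathbb Q_l$, and let $\mathrm{Frob}$ act on $\mathrm{GL}_n(k)$ entrywise by $x\mapsto x^{|k'|}$. Let $(\rho,V)$ be an irreducible representation of $\mathrm{GL}_n(k)$ over $\overline{\mathbb Q_l}$ such that: - $\rho$ is cuspidal: for every $1\le m\le n-1$ and every representation $\tau$ of the Levi factor $\mathrm{GL}_m(k)\times\mathrm{GL}_{n-m}(k)$ of the standard maximal parabolic subgroup $P_m$, inflated to $P_m$, one has $\mathrm{Hom}_{\mathrm{GL}_n(k)}\big(\rho,\mathrm{Ind}_{P_m}^{\mathrm{GL}_n(k)}\tau\big)=0$; - $\rho$ is integral: $V$ contains a $\mathrm{GL}_n(k)$-stable $\overline{\mathbb Z_l}$-lattice, i.e. a stable finitely generated $\overline{\mathbb Z_l}$-submodule spanning $V$ over $\overline{\mathbb Q_l}$; - $\rho$ is Frobenius-fixed: $\rho\cong\rho\circ\mathrm{Frob}$.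 Let $\varepsilon:k'\to\overline{\mathbb Q_l}^{\times}$ be a nontrivial additive character, and let $\psi(u)=\varepsilon\big(\mathrm{Tr}_{k/k'}(u_{1,2}+\dots+u_{n-1,n})\big)$ be the corresponding character of the group $U_n$ of upper triangular unipotent matrices in $\mathrm{GL}_n(k)$. Then there is exactly one $\overline{\mathbb Q_l}$-linear operator $T:V\to V$ such that $T\rho(g)=\rho(\mathrm{Frob}(g))T$ for all $g\in\mathrm{GL}_n(k)$, $T^l=1$, and $Tv=v$ for every $v\in V$ with $\rho(u)v=\psi(u)v$ for all $u\in U_n$. For this operator and for every $\mathrm{GL}_n(k)$-stable $\overline{\mathbb Z_l}$-lattice $L\subset V$ one has $T(L)\subseteq L$, and the Tate cohomology $$T^1(L)=\ker\big(1+T+\dots+T^{l-1}:L\to L\big)\big/(1-T)L$$ is zero. In other words, $T^1(\rho)=0$. -/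

import Mathlib

open scoped MatrixGroups

noncomputable section

namespace TateGL

universe u v w

/-- An algebraic closure of the field of `l`-adic numbers. -/
abbrev QlBar (l : ℕ) [Fact l.Prime] : Type := AlgebraicClosure ℚ_[l]

/-- The integral closure of the `l`-adic integers in `QlBar l`. -/
abbrev ZlBar (l : ℕ) [Fact l.Prime] : Subalgebra ℤ_[l] (QlBar l) :=
  integralClosure ℤ_[l] (QlBar l)

section Groups

variable {k : Type v} [Field k] {n : ℕ}

/-- The maximal standard parabolic subgroup of `GL_n(k)` of matrices whose lower left
`(n - m) × m` block vanishes. -/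
def parabolic (k : Type v) [Field k] (n m : ℕ) : Subgroup (GL (Fin n) k) where
  carrier := {g | (g : Matrix (Fin n) (Fin n) k).BlockTriangular
    fun i => decide (m ≤ (i : ℕ))}
  mul_mem' {a b} ha hb := by
    simp only [Set.mem_ofPred_eq, Units.val_mul] at ha hb ⊢
    exact ha.mul hb
  one_mem' := Matrix.blockTriangular_one
  inv_mem' {a} ha := by
    simp only [Set.mem_ofPred_eq] at ha ⊢
    have : Invertible (a : Matrix (Fin n) (Fin n) k) := a.invertible
    rw [Matrix.coe_units_inv]
    exact Matrix.blockTriangular_inv_of_blockTriangular ha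

/-- Membership in the unipotent radical of `parabolic k n m`: `g` agrees with the identity
outside the upper right `m × (n - m)` block. -/
def InUnipotentRadical (m : ℕ) (g : GL (Fin n) k) : Prop :=
  ∀ i j : Fin n, ¬ ((i : ℕ) < m ∧ m ≤ (j : ℕ)) →
    (g : Matrix (Fin n) (Fin n) k) i j = (1 : Matrix (Fin n) (Fin n) k) i j

/-- Membership in the group `U_n` of upper triangular unipotent matrices. -/
def IsUnipotentUpper (g : GL (Fin n) k) : Prop :=
  ∀ i j : Fin n, j ≤ i →
    (g : Matrix (Fin n) (Fin n) k) i j = (1 : Matrix (Fin n) (Fin n) k) i j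

/-- The sum of the entries `g_{1,2} + g_{2,3} + ⋯ + g_{n-1,n}` just above the diagonal. -/
def superdiagSum (g : GL (Fin n) k) : k :=
  ∑ i : Fin n, ∑ j : Fin n,
    if (j : ℕ) = i + 1 then (g : Matrix (Fin n) (Fin n) k) i j else 0

/-- The entrywise action on `GL_n(k)` of the Frobenius `x ↦ x ^ |k'|` of `k` over `k'`. -/
def frobGL (k' : Type w) [Field k'] [Fintype k'] (k : Type v) [Field k] [Algebra k' k] (n : ℕ) :
    GL (Fin n) k →* GL (Fin n) k :=
  Matrix.GeneralLinearGroup.map (FiniteField.frobeniusAlgHom k' k : k →+* k)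

end Groups

section Representations

variable {K : Type w} [Field K] {k : Type v} [Field k] {n : ℕ}
  {V : Type u} [AddCommGroup V] [Module K V]

/-- `ρ` is cuspidal: there is no nonzero `GL_n(k)`-homomorphism from `ρ` to a representation
parabolically induced from a maximal standard parabolic subgroup. A representation of the Levi
factor, inflated to the parabolic, is the same as a representation `τ` of the parabolic that is
trivial on its unipotent radical. The induced representation is the space of functions
`f : GL_n(k) → W` with `f (p g) = τ p (f g)`, with `GL_n(k)` acting by right translation. -/
def IsCuspidal (ρ : Representation K (GL (Fin n) k) V) : Prop :=
  ∀ m : ℕ, 1 ≤ m → m < n →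
    ∀ (W : Type u) [AddCommGroup W] [Module K W] (τ : Representation K (parabolic k n m) W),
      (∀ p : parabolic k n m, InUnipotentRadical m (p : GL (Fin n) k) → τ p = 1) →
        ∀ f : ρ.IntertwiningMap (Representation.coind (parabolic k n m).subtype τ), f = 0

end Representations

section Tate

variable {R : Type*} [CommRing R] {M : Type*} [AddCommGroup M] [Module R M]

/-- The norm `1 + T + ⋯ + T ^ (l - 1)`. -/
def tateNorm (l : ℕ) (T : Module.End R M) : Module.End R M :=
  ∑ i ∈ Finset.range l, T ^ i

/-- The Tate cohomology `T¹ = ker (1 + T + ⋯ + T ^ (l - 1)) / im (1 - T)` of an endomorphism `T`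
with `T ^ l = 1`. -/
abbrev TateH1 (l : ℕ) (T : Module.End R M) : Type _ :=
  LinearMap.ker (tateNorm l T) ⧸
    (LinearMap.range (1 - T)).submoduleOf (LinearMap.ker (tateNorm l T))

end Tate

section Integral

variable {l : ℕ} [Fact l.Prime] {k' : Type w} [Field k'] [Fintype k']
  {k : Type v} [Field k] [Algebra k' k] {n : ℕ}
  {V : Type u} [AddCommGroup V] [Module (QlBar l) V]

/-- `L` is a `ZlBar l`-lattice in `V` (finitely generated and spanning `V`) that is stable
under the action of `GL_n(k)`. -/
structure IsInvariantLattice (ρ : Representation (QlBar l) (GL (Fin n) k) V)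
    (L : Submodule (ZlBar l) V) : Prop where
  isLattice : Submodule.IsLattice (QlBar l) L
  stable : ∀ (g : GL (Fin n) k), ∀ x ∈ L, ρ g x ∈ L

/-- `ρ` is integral: it admits an invariant lattice. -/
def IsIntegralRep (ρ : Representation (QlBar l) (GL (Fin n) k) V) : Prop :=
  ∃ L : Submodule (ZlBar l) V, IsInvariantLattice ρ L

/-- `ρ` is fixed by the Frobenius of `k` over `k'`: `ρ` and `ρ ∘ Frob` are isomorphic. -/
def IsFrobFixed (k' : Type w) [Field k'] [Fintype k'] [Algebra k' k]
    (ρ : Representation (QlBar l) (GL (Fin n) k) V) : Prop :=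
  Nonempty (Representation.Equiv ρ (MonoidHom.comp ρ (frobGL k' k n)))

/-- `T` is an isomorphism from `ρ` to `ρ ∘ Frob` with `T ^ l = 1`, normalized by the requirement
that it fixes every vector of `V` on which the group `U_n` of upper triangular unipotent matrices
acts through the character `u ↦ ε (Tr_{k/k'} (u_{1,2} + ⋯ + u_{n-1,n}))`. -/
structure IsFrobOperator (ρ : Representation (QlBar l) (GL (Fin n) k) V)
    (ε : AddChar k' (QlBar l)) (T : Module.End (QlBar l) V) : Prop where
  intertwines : ∀ (g : GL (Fin n) k) (x : V), T (ρ g x) = ρ (frobGL k' k n g) (T x)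
  pow_eq_one : T ^ l = 1
  normalized : ∀ x : V,
    (∀ u : GL (Fin n) k, IsUnipotentUpper u →
      ρ u x = ε (Algebra.trace k' k (superdiagSum u)) • x) → T x = x

end Integral

end TateGL

end

/-!
Filter `V` by `W 0 ⊆ W 1 ⊆ ⋯ ⊆ V`, where `W c` consists of the vectors on which the unitriangular
matrices that differ from the identity only in columns of index greater than `c` act through `ψ`.
The unipotent matrices supported in column `c + 1` form a finite abelian group of order prime to
`l`, so they split a vector of `W (c + 1)`, and even of `W (c + 1) ∩ L`, into eigencomponents
indexed by row vectors over `k`. The component at `0` vanishes by cuspidality; a component at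
`y ≠ 0` is carried into `W c` by an element of `GL`, which can be taken Frobenius-fixed if `y` is. A
Frobenius operator permutes the components along the action of Frobenius on the `y`: orbits of
length `l` are induced and contribute no cohomology, while the fixed `y` reduce to `W c`. On the
Whittaker space `W 0` the operator is the identity, and the norm is multiplication by `l`, which is
injective. The same induction shows that the operator is unique, has order dividing `l` and
preserves `L`.

For existence, the Whittaker space is at most a line: the reflection in the antidiagonal is an
anti-automorphism of `GL` fixing `ψ`, and by the Bruhat decomposition it fixes the Hecke algebra of
`ψ` elementwise, since every monomial matrix supporting a nonzero element is fixed by it. Hence that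
algebra is commutative, and an isomorphism of `ρ` with its Frobenius twist can be rescaled to be the
identity on the Whittaker line.
-/

noncomputable section

namespace TateGL

universe u v w

section Characters

variable {K : Type*} [Field K] {H : Type*} [Group H] {V : Type*} [AddCommGroup V] [Module K V]
  (ρ : Representation K H V) (χ : H →* K)

/-- The eigenspace of the character `χ` in the representation `ρ`. -/
def charSpace : Submodule K V where
  carrier := {x | ∀ h, ρ h x = χ h • x}
  zero_mem' := by simp
  add_mem' hx hy h := by rw [map_add, hx h, hy h, smul_add]
  smul_mem' a x hx h := by rw [map_smul, hx h, smul_comm]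

/-- The projection onto `charSpace ρ χ` given by averaging over the finite group `H`. -/
def charProj : Module.End K V :=
  (Nat.card H : K)⁻¹ • ∑ᶠ h, χ h⁻¹ • ρ h

variable {ρ χ}

lemma charProj_eq_sum [Fintype H] :
    charProj ρ χ = (Nat.card H : K)⁻¹ • ∑ h : H, χ h⁻¹ • ρ h := by
  rw [charProj, finsum_eq_sum_of_fintype]

lemma charProj_apply [Fintype H] (x : V) :
    charProj ρ χ x = (Nat.card H : K)⁻¹ • ∑ h, χ h⁻¹ • ρ h x := by
  simp only [charProj_eq_sum, LinearMap.smul_apply, LinearMap.sum_apply]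

lemma charProj_mem {R : Type*} [CommRing R] [Algebra R K] [Module R V] [IsScalarTower R K V]
    [Finite H] {L : Submodule R V} (hcard : ∀ x ∈ L, (Nat.card H : K)⁻¹ • x ∈ L)
    (hχ : ∀ h, ∀ x ∈ L, χ h • x ∈ L) (hρ : ∀ h, ∀ x ∈ L, ρ h x ∈ L) {x : V} (hx : x ∈ L) :
    charProj ρ χ x ∈ L := by
  cases nonempty_fintype H
  rw [charProj_apply]
  exact hcard _ (L.sum_mem fun h _ => hχ _ _ (hρ _ _ hx))

lemma mul_charProj [Finite H] (g : H) : ρ g * charProj ρ χ = χ g • charProj ρ χ := by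
  cases nonempty_fintype H
  rw [charProj_eq_sum, mul_smul_comm, smul_comm (χ g) (Nat.card H : K)⁻¹, Finset.mul_sum]
  congr 1
  rw [Finset.smul_sum]
  refine Fintype.sum_equiv (Equiv.mulLeft g) _ _ fun h => ?_
  rw [Equiv.coe_mulLeft, mul_smul_comm, ← map_mul, smul_smul, mul_comm (χ g), ← map_mul χ,
    mul_inv_rev, inv_mul_cancel_right]

lemma charProj_mul [Finite H] (g : H) : charProj ρ χ * ρ g = χ g • charProj ρ χ := by
  cases nonempty_fintype H
  rw [charProj_eq_sum, smul_mul_assoc, smul_comm (χ g) (Nat.card H : K)⁻¹, Finset.sum_mul]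
  congr 1
  rw [Finset.smul_sum]
  refine Fintype.sum_equiv (Equiv.mulRight g) _ _ fun h => ?_
  rw [Equiv.coe_mulRight, smul_mul_assoc, ← map_mul, smul_smul, ← map_mul χ, mul_inv_rev,
    mul_inv_cancel_left]

lemma charProj_apply_mem_charSpace [Finite H] (x : V) : charProj ρ χ x ∈ charSpace ρ χ :=
  fun h => LinearMap.congr_fun (mul_charProj h) x

lemma charProj_apply_of_mem [Finite H] [CharZero K] {x : V} (hx : x ∈ charSpace ρ χ) :
    charProj ρ χ x = x := by
  cases nonempty_fintype H
  have hterm (h : H) : χ h⁻¹ • ρ h x = x := by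
    rw [hx h, smul_smul, ← map_mul, inv_mul_cancel, map_one, one_smul]
  rw [charProj_apply, Finset.sum_congr rfl fun h _ => hterm h, Finset.sum_const, Finset.card_univ,
    ← Nat.card_eq_fintype_card, ← Nat.cast_smul_eq_nsmul K, smul_smul,
    inv_mul_cancel₀ (Nat.cast_ne_zero.2 Nat.card_pos.ne'), one_smul]

lemma charProj_mul_self [Finite H] [CharZero K] :
    charProj ρ χ * charProj ρ χ = charProj ρ χ :=
  LinearMap.ext fun x => charProj_apply_of_mem (charProj_apply_mem_charSpace x)

lemma apply_charProj_of_intertwines [Finite H] {ρ' : Representation K H V} {χ' : H →* K}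
    (e : H ≃* H) (hχ : ∀ h, χ' (e h) = χ h) {T : Module.End K V}
    (hT : ∀ h x, T (ρ h x) = ρ' (e h) (T x)) (x : V) :
    T (charProj ρ χ x) = charProj ρ' χ' (T x) := by
  cases nonempty_fintype H
  rw [charProj_apply, charProj_apply, map_smul, map_sum]
  congr 1
  refine Fintype.sum_equiv e.toEquiv _ _ fun h => ?_
  rw [map_smul, hT, MulEquiv.toEquiv_eq_coe, MulEquiv.coe_toEquiv, ← map_inv, hχ]

end Characters

section Irreducible

variable {K : Type*} [Field K] {G : Type*} [Group G] {V : Type*} [AddCommGroup V] [Module K V]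
  {ρ : Representation K G V}

lemma nontrivial_of_isIrreducible (hρ : ρ.IsIrreducible) : Nontrivial V := by
  obtain ⟨p, q, hpq⟩ := hρ.exists_pair_ne
  by_contra hV
  rw [not_nontrivial_iff_subsingleton] at hV
  exact hpq (Subrepresentation.toSubmodule_injective (Subsingleton.elim _ _))

lemma span_orbit_eq_top (hρ : ρ.IsIrreducible) {x : V} (hx : x ≠ 0) :
    Submodule.span K (Set.range fun g => ρ g x) = ⊤ := by
  let S : Subrepresentation ρ :=
    { toSubmodule := Submodule.span K (Set.range fun g => ρ g x)
      apply_mem_toSubmodule := fun g y hy => by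
        induction hy using Submodule.span_induction with
        | mem y hy =>
          obtain ⟨h, rfl⟩ := hy
          exact Submodule.subset_span ⟨g * h, by simp only [map_mul, Module.End.mul_apply]⟩
        | zero => simp only [map_zero, Submodule.zero_mem]
        | add y z _ _ hy hz => rw [map_add]; exact Submodule.add_mem _ hy hz
        | smul a y _ hy => rw [map_smul]; exact Submodule.smul_mem _ a hy }
  have hxS : x ∈ S.toSubmodule := Submodule.subset_span ⟨1, by simp⟩
  rcases hρ.eq_bot_or_eq_top S with hS | hS
  · rw [hS] at hxS
    exact absurd ((Submodule.mem_bot K).1 hxS) hx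
  · exact congrArg Subrepresentation.toSubmodule hS

lemma finiteDimensional_of_isIrreducible [Finite G] (hρ : ρ.IsIrreducible) :
    FiniteDimensional K V := by
  have := nontrivial_of_isIrreducible hρ
  obtain ⟨x, hx⟩ := exists_ne (0 : V)
  exact ⟨(Set.finite_range fun g => ρ g x).toFinset, by
    rw [Set.Finite.coe_toFinset, span_orbit_eq_top hρ hx]⟩

end Irreducible

section Gelfand

variable {K : Type*} [Field K] {G : Type*} [Group G] {V : Type*} [AddCommGroup V] [Module K V]
  {H : Subgroup G} [Finite H] (ρ : Representation K G V) (χ : H →* K)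

/-- The element `e g e` of the Hecke algebra of `χ`, where `e` is the idempotent of `χ`, acting
on `ρ`. -/
def heckeOp (g : G) : Module.End K V :=
  charProj (ρ.comp H.subtype) χ * ρ g * charProj (ρ.comp H.subtype) χ

variable {ρ χ}

lemma heckeOp_mul_left (h : H) (g : G) : heckeOp ρ χ (h * g) = χ h • heckeOp ρ χ g := by
  have hmul := charProj_mul (ρ := ρ.comp H.subtype) (χ := χ) h
  rw [MonoidHom.comp_apply, Subgroup.subtype_apply] at hmul
  rw [heckeOp, map_mul, ← mul_assoc, hmul, smul_mul_assoc, smul_mul_assoc, heckeOp]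

lemma heckeOp_mul_right (g : G) (h : H) : heckeOp ρ χ (g * h) = χ h • heckeOp ρ χ g := by
  have hmul := mul_charProj (ρ := ρ.comp H.subtype) (χ := χ) h
  rw [MonoidHom.comp_apply, Subgroup.subtype_apply] at hmul
  rw [heckeOp, map_mul, ← mul_assoc, mul_assoc _ (ρ (h : G)), hmul, mul_smul_comm, heckeOp]

lemma heckeOp_mul_heckeOp [CharZero K] [Fintype H] (g g' : G) :
    heckeOp ρ χ g * heckeOp ρ χ g' =
      (Nat.card H : K)⁻¹ • ∑ h : H, χ h⁻¹ • heckeOp ρ χ (g * h * g') := by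
  set e := charProj (ρ.comp H.subtype) χ with he
  calc heckeOp ρ χ g * heckeOp ρ χ g'
      = e * ρ g * (e * e) * ρ g' * e := by simp only [heckeOp, mul_assoc, he]
    _ = e * ρ g * ((Nat.card H : K)⁻¹ • ∑ h : H, χ h⁻¹ • ρ h) * ρ g' * e := by
        rw [he, charProj_mul_self, charProj_eq_sum]; rfl
    _ = _ := by
        simp only [mul_smul_comm, smul_mul_assoc, Finset.mul_sum, Finset.sum_mul, heckeOp, map_mul,
          mul_assoc, he]

theorem commute_heckeOp [CharZero K] {τ : G → G} (hτ_mul : ∀ g h, τ (g * h) = τ h * τ g)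
    (hτ_inv : Function.Involutive τ) (hτ_mem : ∀ h ∈ H, τ h ∈ H)
    (hχ : ∀ h : H, χ ⟨τ h, hτ_mem h h.2⟩ = χ h) (hτ : ∀ g, heckeOp ρ χ (τ g) = heckeOp ρ χ g)
    (g g' : G) : Commute (heckeOp ρ χ g) (heckeOp ρ χ g') := by
  cases nonempty_fintype H
  have hτ_one : τ 1 = 1 := mul_eq_left.1 ((hτ_mul 1 1).symm.trans (congrArg τ (one_mul 1)))
  let τH : H ≃ H := Function.Involutive.toPerm (fun h => ⟨τ h, hτ_mem h h.2⟩)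
    fun h => Subtype.ext (hτ_inv h)
  have hχ_inv (h : H) : χ (τH h)⁻¹ = χ h⁻¹ := by
    rw [← hχ h⁻¹]
    congr 1
    exact inv_eq_of_mul_eq_one_left
      (Subtype.ext ((hτ_mul _ _).symm.trans
        (by rw [Subgroup.coe_inv, mul_inv_cancel, hτ_one]; rfl)))
  calc heckeOp ρ χ g * heckeOp ρ χ g'
      = (Nat.card H : K)⁻¹ • ∑ h : H, χ h⁻¹ • heckeOp ρ χ (τ (g * h * g')) := by
        simp only [heckeOp_mul_heckeOp, hτ]
    _ = (Nat.card H : K)⁻¹ • ∑ h : H, χ h⁻¹ • heckeOp ρ χ (τ g' * h * τ g) := by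
        congr 1
        refine Fintype.sum_equiv τH _ _ fun h => ?_
        rw [hχ_inv, hτ_mul, hτ_mul, ← mul_assoc]
        rfl
    _ = heckeOp ρ χ g' * heckeOp ρ χ g := by rw [← heckeOp_mul_heckeOp, hτ, hτ]

lemma heckeOp_apply_mem (g : G) (x : V) :
    heckeOp ρ χ g x ∈ charSpace (ρ.comp H.subtype) χ :=
  charProj_apply_mem_charSpace _

lemma heckeOp_apply_of_mem [CharZero K] (g : G) {x : V}
    (hx : x ∈ charSpace (ρ.comp H.subtype) χ) :
    heckeOp ρ χ g x = charProj (ρ.comp H.subtype) χ (ρ g x) := by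
  rw [heckeOp, Module.End.mul_apply, charProj_apply_of_mem hx, Module.End.mul_apply]

lemma mem_span_range_heckeOp [CharZero K] (hρ : ρ.IsIrreducible) {x y : V} (hx₀ : x ≠ 0)
    (hx : x ∈ charSpace (ρ.comp H.subtype) χ) (hy : y ∈ charSpace (ρ.comp H.subtype) χ) :
    y ∈ Submodule.span K (Set.range fun g => heckeOp ρ χ g x) := by
  have hy_orbit : y ∈ Submodule.span K (Set.range fun g => ρ g x) := by
    rw [span_orbit_eq_top hρ hx₀]
    trivial
  have hy_proj := Submodule.mem_map_of_mem (f := charProj (ρ.comp H.subtype) χ) hy_orbit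
  rw [charProj_apply_of_mem hy, Submodule.map_span, ← Set.range_comp] at hy_proj
  simpa only [heckeOp_apply_of_mem _ hx, Function.comp_def] using hy_proj

variable [CharZero K] [IsAlgClosed K] [FiniteDimensional K V]

lemma exists_heckeOp_apply_eq_smul (hρ : ρ.IsIrreducible)
    (hcomm : ∀ g g', Commute (heckeOp ρ χ g) (heckeOp ρ χ g')) (g : G) :
    ∃ a : K, ∀ y ∈ charSpace (ρ.comp H.subtype) χ, heckeOp ρ χ g y = a • y := by
  rcases subsingleton_or_nontrivial (charSpace (ρ.comp H.subtype) χ) with hW | hW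
  · exact ⟨0, fun y hy => by
      have hy₀ : y = 0 := congrArg Subtype.val (Subsingleton.elim (⟨y, hy⟩ : charSpace _ χ) 0)
      rw [hy₀, map_zero, smul_zero]⟩
  · obtain ⟨a, ha⟩ := Module.End.exists_eigenvalue
      ((heckeOp ρ χ g).restrict fun y (_ : y ∈ charSpace (ρ.comp H.subtype) χ) =>
        heckeOp_apply_mem g y)
    obtain ⟨⟨z, hz⟩, hz_eigen⟩ := ha.exists_hasEigenvector
    have hz₀ : z ≠ 0 := fun h => hz_eigen.2 (Subtype.ext h)
    have hz_apply : heckeOp ρ χ g z = a • z := congrArg Subtype.val hz_eigen.apply_eq_smul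
    refine ⟨a, fun y hy => ?_⟩
    have hle : Submodule.span K (Set.range fun g' => heckeOp ρ χ g' z) ≤
        LinearMap.eqLocus (heckeOp ρ χ g) (a • LinearMap.id) := by
      rw [Submodule.span_le]
      rintro _ ⟨g', rfl⟩
      exact (LinearMap.congr_fun (hcomm g g') z).trans
        ((congrArg (heckeOp ρ χ g') hz_apply).trans (map_smul _ a z))
    exact hle (mem_span_range_heckeOp hρ hz₀ hz hy)

theorem exists_eq_smul_of_commute_heckeOp (hρ : ρ.IsIrreducible)
    (hcomm : ∀ g g', Commute (heckeOp ρ χ g) (heckeOp ρ χ g')) {x y : V} (hx₀ : x ≠ 0)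
    (hx : x ∈ charSpace (ρ.comp H.subtype) χ) (hy : y ∈ charSpace (ρ.comp H.subtype) χ) :
    ∃ a : K, a • x = y := by
  have hle : Submodule.span K (Set.range fun g => heckeOp ρ χ g x) ≤ K ∙ x := by
    rw [Submodule.span_le]
    rintro _ ⟨g, rfl⟩
    obtain ⟨a, ha⟩ := exists_heckeOp_apply_eq_smul hρ hcomm g
    exact Submodule.mem_span_singleton.2 ⟨a, (ha x hx).symm⟩
  exact Submodule.mem_span_singleton.1 (hle (mem_span_range_heckeOp hρ hx₀ hx hy))

end Gelfand

section Tate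

/-- The equivalence relation of lying on a common orbit of a map all of whose points have period
`l`. -/
def orbitSetoid {Y : Type*} {φ : Y → Y} {l : ℕ} (hφ : ∀ y, φ^[l] y = y) (hl : 0 < l) :
    Setoid Y where
  r y z := ∃ i, φ^[i] y = z
  iseqv.refl y := ⟨0, rfl⟩
  iseqv.symm := by
    rintro y _ ⟨i, rfl⟩
    refine ⟨(l - 1) * i, ?_⟩
    rw [← Function.iterate_add_apply, ← Nat.succ_mul, Nat.succ_eq_add_one, Nat.sub_add_cancel hl]
    exact Function.IsPeriodicPt.mul_const (hφ y) i
  iseqv.trans := by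
    rintro y _ _ ⟨i, rfl⟩ ⟨j, rfl⟩
    exact ⟨j + i, Function.iterate_add_apply φ j i y⟩

lemma sum_orbit_eq_sum_minimalPeriod {Y A : Type*} [AddCommMonoid A] [Fintype Y] {φ : Y → Y}
    {l : ℕ} (hφ : ∀ y, φ^[l] y = y) (hl : 0 < l) (f : Y → A) (y : Y)
    [DecidablePred fun z => orbitSetoid hφ hl y z] :
    ∑ z with orbitSetoid hφ hl y z, f z =
      ∑ i ∈ Finset.range (Function.minimalPeriod φ y), f (φ^[i] y) := by
  refine (Finset.sum_bij (fun i _ => φ^[i] y) (fun i _ => ?_) ?_ (fun z hz => ?_)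
    fun _ _ => rfl).symm
  · exact Finset.mem_filter.2 ⟨Finset.mem_univ _, i, rfl⟩
  · simpa [Set.InjOn] using Function.iterate_injOn_Iio_minimalPeriod (f := φ) (x := y)
  · obtain ⟨i, rfl⟩ := (Finset.mem_filter.1 hz).2
    have hpos : 0 < Function.minimalPeriod φ y :=
      Function.IsPeriodicPt.minimalPeriod_pos hl (hφ y)
    exact ⟨_, Finset.mem_range.2 (Nat.mod_lt i hpos), Function.iterate_mod_minimalPeriod_eq⟩

lemma sum_mem_of_sum_orbit_mem {Y A : Type*} [AddCommMonoid A] [Fintype Y] {φ : Y → Y} {l : ℕ}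
    (hl : l.Prime) (hφ : ∀ y, φ^[l] y = y) {f : Y → A} {S : AddSubmonoid A}
    (hfixed : ∀ y, φ y = y → f y ∈ S)
    (horbit : ∀ y, ∑ i ∈ Finset.range l, f (φ^[i] y) ∈ S) : ∑ y, f y ∈ S := by
  classical
  rw [Finset.sum_partition (orbitSetoid hφ hl.pos)]
  refine S.sum_mem fun q _ => ?_
  induction q using Quotient.inductionOn with | _ y
  simp only [eq_comm (b := Quotient.mk _ y), Quotient.eq]
  rw [sum_orbit_eq_sum_minimalPeriod hφ hl.pos f y]
  rcases (Nat.dvd_prime hl).1 (Function.IsPeriodicPt.minimalPeriod_dvd (hφ y)) with h | h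
  · rw [h, Finset.sum_range_one]
    exact hfixed y (Function.minimalPeriod_eq_one_iff_isFixedPt.1 h)
  · rw [h]
    exact horbit y

variable {R : Type*} [CommRing R] {M : Type*} [AddCommGroup M] [Module R M] {l : ℕ}
  {T : Module.End R M}

lemma tateNorm_apply (x : M) : tateNorm l T x = ∑ i ∈ Finset.range l, (T ^ i) x := by
  simp only [tateNorm, LinearMap.sum_apply]

lemma tateNorm_apply_of_fixed {x : M} (hx : T x = x) : tateNorm l T x = l • x := by
  have hpow (i : ℕ) : (T ^ i) x = x := by
    rw [Module.End.pow_apply, Function.iterate_fixed hx]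
  simp only [tateNorm_apply, hpow, Finset.sum_const, Finset.card_range]

lemma tateNorm_apply_of_commute {A : Module.End R M} (hA : Commute A T) (x : M) :
    tateNorm l T (A x) = A (tateNorm l T x) :=
  (LinearMap.congr_fun (Commute.sum_right _ _ _ fun i _ => hA.pow_right i : Commute A _).eq x).symm

lemma sub_pow_apply_mem_map {L : Submodule R M} (hT : ∀ x ∈ L, T x ∈ L) (i : ℕ) {x : M}
    (hx : x ∈ L) : x - (T ^ i) x ∈ L.map (1 - T) := by
  have hpow (j : ℕ) : (T ^ j) x ∈ L := Module.End.pow_apply_mem_of_forall_mem j hT x hx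
  have hfactor := LinearMap.congr_fun (mul_neg_geom_sum T i) x
  exact ⟨_, by rw [LinearMap.sum_apply]; exact L.sum_mem fun j _ => hpow j, hfactor⟩

lemma pow_apply_of_semiconj {Y : Type*} {φ : Y → Y} {P : Y → Module.End R M}
    (hTP : ∀ y x, T (P y x) = P (φ y) (T x)) (i : ℕ) (y : Y) (x : M) :
    (T ^ i) (P y x) = P (φ^[i] y) ((T ^ i) x) := by
  induction i with
  | zero => rfl
  | succ i ih =>
    rw [pow_succ', Module.End.mul_apply, ih, hTP, Function.iterate_succ_apply']
    rfl

-- Each `T ^ (l - i)` moves `P (φ^[i] y) x` to `P y (T ^ (l - i) x)`, and these add up to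
-- `P y (T (tateNorm l T x)) = 0`.
lemma sum_iterate_mem_map_one_sub {L : Submodule R M} (hT : ∀ x ∈ L, T x ∈ L) {Y : Type*}
    {φ : Y → Y} (hφ : ∀ y, φ^[l] y = y) {P : Y → Module.End R M}
    (hTP : ∀ y x, T (P y x) = P (φ y) (T x)) (hP : ∀ y, ∀ x ∈ L, P y x ∈ L) {x : M} (hx : x ∈ L)
    (hnorm : tateNorm l T x = 0) (y : Y) :
    ∑ i ∈ Finset.range l, P (φ^[i] y) x ∈ L.map (1 - T) := by
  have hmove : ∀ i ∈ Finset.range l,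
      (T ^ (l - i)) (P (φ^[i] y) x) = P y ((T ^ (l - i)) x) := fun i hi => by
    rw [pow_apply_of_semiconj hTP, ← Function.iterate_add_apply,
      Nat.sub_add_cancel (Finset.mem_range.1 hi).le, hφ]
  have hzero : ∑ i ∈ Finset.range l, (T ^ (l - i)) (P (φ^[i] y) x) = 0 :=
    calc ∑ i ∈ Finset.range l, (T ^ (l - i)) (P (φ^[i] y) x)
        = P y (∑ i ∈ Finset.range l, (T ^ (l - i)) x) := by
          rw [Finset.sum_congr rfl hmove, map_sum]
      _ = P y (T (tateNorm l T x)) := by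
          rw [tateNorm_apply, map_sum T, ← Finset.sum_range_reflect]
          refine congrArg (P y) (Finset.sum_congr rfl fun i hi => ?_)
          rw [show l - (l - 1 - i) = i + 1 by have := Finset.mem_range.1 hi; omega, pow_succ',
            Module.End.mul_apply]
      _ = 0 := by rw [hnorm, map_zero, map_zero]
  rw [← sub_zero (∑ i ∈ Finset.range l, _), ← hzero, ← Finset.sum_sub_distrib]
  exact Submodule.sum_mem _ fun i _ => sub_pow_apply_mem_map hT _ (hP _ x hx)

theorem mem_map_one_sub_of_fixed {L : Submodule R M} (hl : l.Prime) (hT : ∀ x ∈ L, T x ∈ L)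
    {Y : Type*} [Fintype Y] {φ : Y → Y} (hφ : ∀ y, φ^[l] y = y) {P : Y → Module.End R M}
    (hsum : ∑ y, P y = 1) (hTP : ∀ y x, T (P y x) = P (φ y) (T x))
    (hP : ∀ y, ∀ x ∈ L, P y x ∈ L) {x : M} (hx : x ∈ L) (hnorm : tateNorm l T x = 0)
    (hfixed : ∀ y, φ y = y → P y x ∈ L.map (1 - T)) : x ∈ L.map (1 - T) := by
  have hx_sum : ∑ y, P y x = x := by rw [← LinearMap.sum_apply, hsum, Module.End.one_apply]
  rw [← hx_sum]
  exact sum_mem_of_sum_orbit_mem (S := (L.map (1 - T)).toAddSubmonoid) hl hφ hfixed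
    (sum_iterate_mem_map_one_sub hT hφ hTP hP hx hnorm)

lemma subsingleton_tateH1_restrict {L : Submodule R M} (hT : ∀ x ∈ L, T x ∈ L)
    (h : ∀ x ∈ L, tateNorm l T x = 0 → x ∈ L.map (1 - T)) :
    Subsingleton (TateH1 l (T.restrict hT)) := by
  rw [Submodule.Quotient.subsingleton_iff, Submodule.submoduleOf_eq_top]
  rintro ⟨x, hx⟩ hnorm
  have hnorm_coe : tateNorm l T x = 0 := by
    have hsum := congrArg L.subtype (LinearMap.mem_ker.1 hnorm)
    rw [tateNorm_apply, map_sum] at hsum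
    rw [tateNorm_apply, ← map_zero L.subtype, ← hsum]
    exact Finset.sum_congr rfl fun i _ => by rw [Module.End.pow_restrict]; rfl
  obtain ⟨y, hy, hyx⟩ := h x hx hnorm_coe
  exact ⟨⟨y, hy⟩, Subtype.ext hyx⟩

end Tate

section UnitDescents

/-- Every descent of the sequence `f` is by exactly one. A permutation with this property reverses
each block of some partition of `ℕ` into intervals. -/
def HasUnitDescents (f : ℕ → ℕ) : Prop :=
  ∀ i, f (i + 1) < f i → f (i + 1) + 1 = f i

variable {f : ℕ → ℕ}

lemma HasUnitDescents.add_apply_eq_or_lt (hf : HasUnitDescents f) (hinj : f.Injective) {i j : ℕ}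
    (hij : i ≤ j) : (∀ t, i ≤ t → t ≤ j → t + f t = i + f i) ∨ f i < f j := by
  induction j, hij using Nat.le_induction with
  | base => exact Or.inl fun t h₁ h₂ => by rw [le_antisymm h₂ h₁]
  | succ j hij ih =>
    have hne : f (j + 1) ≠ f j := hinj.ne j.succ_ne_self
    have hne_i : f (j + 1) ≠ f i := hinj.ne (by omega)
    rcases ih with hblock | hlt
    · rcases hne.lt_or_gt with hdesc | hasc
      · refine Or.inl fun t h₁ h₂ => ?_
        rcases h₂.lt_or_eq with h | rfl
        · exact hblock t h₁ (by omega)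
        · have := hf j hdesc
          have := hblock j hij le_rfl
          omega
      · refine Or.inr (lt_of_not_ge fun hle => ?_)
        -- The block has already taken every value between `f j` and `f i`.
        have hj := hblock j hij le_rfl
        have htaken := hblock (i + f i - f (j + 1)) (by omega) (by omega)
        have := @hinj (i + f i - f (j + 1)) (j + 1) (by omega)
        omega
    · rcases hne.lt_or_gt with hdesc | hasc
      · have := hf j hdesc
        exact Or.inr (by omega)
      · exact Or.inr (hlt.trans hasc)

lemma le_apply_of_forall_lt (hinj : f.Injective) {i : ℕ} (h : ∀ j < i, f j < i) : i ≤ f i := by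
  by_contra! hlt
  obtain ⟨j, hj, hji⟩ := Finset.surj_on_of_inj_on_of_card_le (s := Finset.range i)
    (t := Finset.range i) (fun j _ => f j) (fun j hj => by simpa using h j (by simpa using hj))
    (fun _ _ _ _ heq => hinj heq) le_rfl (f i) (Finset.mem_range.2 hlt)
  exact (Finset.mem_range.1 hj).ne' (hinj hji)

theorem HasUnitDescents.involutive (hf : HasUnitDescents f) (hbij : f.Bijective) :
    f.Involutive := by
  intro i
  induction i using Nat.strong_induction_on with | _ i ih
  by_cases hhit : ∃ j < i, f j = i
  · obtain ⟨j, hj, rfl⟩ := hhit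
    rw [ih j hj]
  by_cases hover : ∃ j < i, i < f j
  · obtain ⟨j, hj, hfj⟩ := hover
    have hmirror := ih j hj
    have hblock := (hf.add_apply_eq_or_lt hbij.injective (hj.trans hfj).le).resolve_right (by omega)
    have hi := hblock i hj.le hfj.le
    have := hblock (f i) (by omega) (by omega)
    omega
  · push Not at hhit hover
    have hle := le_apply_of_forall_lt hbij.injective
      fun j hj => lt_of_le_of_ne (hover j hj) (hhit j hj)
    obtain ⟨j, hj⟩ := hbij.surjective i
    have hij : i ≤ j := not_lt.1 fun h => hhit j h hj
    rcases hf.add_apply_eq_or_lt hbij.injective hij with hblock | hlt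
    · have := hblock j hij le_rfl
      rw [show f i = j by omega, hj]
    · omega

lemma HasUnitDescents.apply_eq_of_descent {α : Type*} (hf : HasUnitDescents f)
    (hbij : f.Bijective) {t : ℕ → α} (ht : ∀ i, f (i + 1) < f i → t (i + 1) = t i) (i : ℕ) :
    t (f i) = t i := by
  have hinv := hf.involutive hbij
  wlog hi : i ≤ f i generalizing i
  · rw [← this (f i) (by rw [hinv]; exact (not_le.1 hi).le), hinv]
  have hblock := hf.add_apply_eq_or_lt hbij.injective hi
  rw [hinv] at hblock
  have hblock := hblock.resolve_right hi.not_gt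
  suffices ∀ j, i ≤ j → j ≤ f i → t j = t i from this _ hi le_rfl
  intro j hij
  induction j, hij using Nat.le_induction with
  | base => exact fun _ => rfl
  | succ j hij ih =>
    intro hj
    have := hblock j hij (by omega)
    have := hblock (j + 1) (by omega) hj
    rw [ht j (by omega), ih (by omega)]

end UnitDescents

section FixedRowsAndColumns

variable {ι : Type*} [Fintype ι] [DecidableEq ι] {R : Type*} [CommRing R]

lemma mul_apply_of_row_eq_one {A : Matrix ι ι R} {i : ι}
    (hA : ∀ m, A i m = (1 : Matrix ι ι R) i m) (B : Matrix ι ι R) (j : ι) :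
    (A * B) i j = B i j := by
  rw [← Matrix.one_mul B, Matrix.mul_apply, Matrix.mul_apply]
  simp only [hA, Matrix.one_mul]

lemma mul_apply_of_column_eq_one (A : Matrix ι ι R) {B : Matrix ι ι R} {j : ι}
    (hB : ∀ m, B m j = (1 : Matrix ι ι R) m j) (i : ι) :
    (A * B) i j = A i j := by
  rw [← Matrix.mul_one A, Matrix.mul_apply, Matrix.mul_apply]
  simp only [hB, Matrix.mul_one]

lemma det_one_updateRow (i : ι) (z : ι → R) : ((1 : Matrix ι ι R).updateRow i z).det = z i := by
  rw [← Matrix.cramer_transpose_apply, Matrix.transpose_one, Matrix.cramer_one,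
    Module.End.one_apply]

/-- The group of invertible matrices whose rows with index in `s` are those of the identity. -/
def fixRows (R : Type*) [CommRing R] (s : Set ι) : Subgroup (GL ι R) where
  carrier := {g | ∀ i ∈ s, ∀ j, g.val i j = (1 : Matrix ι ι R) i j}
  one_mem' _ _ _ := rfl
  mul_mem' ha hb i hi j := by rw [Units.val_mul, mul_apply_of_row_eq_one (ha i hi), hb i hi]
  inv_mem' {a} ha i hi j := (mul_apply_of_row_eq_one (ha i hi) (a⁻¹).val j).symm.trans <| by
    rw [← Units.val_mul, mul_inv_cancel, Units.val_one]

/-- The group of invertible matrices whose columns with index in `s` are those of the identity. -/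
def fixColumns (R : Type*) [CommRing R] (s : Set ι) : Subgroup (GL ι R) where
  carrier := {g | ∀ j ∈ s, ∀ i, g.val i j = (1 : Matrix ι ι R) i j}
  one_mem' _ _ _ := rfl
  mul_mem' ha hb j hj i := by rw [Units.val_mul, mul_apply_of_column_eq_one _ (hb j hj), ha j hj]
  inv_mem' {a} ha j hj i := (mul_apply_of_column_eq_one (a⁻¹).val (ha j hj) i).symm.trans <| by
    rw [← Units.val_mul, inv_mul_cancel, Units.val_one]

lemma conj_val_of_mem {s : Set ι} {q u : GL ι R} (hq : q ∈ fixRows R s)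
    (hu : u ∈ fixColumns R sᶜ) : (q * u * q⁻¹).val = 1 + q.val * (u.val - 1) := by
  have hcancel : (u.val - 1) * (q⁻¹).val = u.val - 1 := by
    ext i j
    rw [Matrix.mul_apply, ← Matrix.mul_one (u.val - 1), Matrix.mul_apply, Matrix.mul_one]
    refine Finset.sum_congr rfl fun m _ => ?_
    by_cases hm : m ∈ s
    · rw [(fixRows R s).inv_mem hq m hm j]
    · rw [Matrix.sub_apply, hu m hm, sub_self, zero_mul, zero_mul]
  calc (q * u * q⁻¹).val = q.val * (1 + (u.val - 1)) * (q⁻¹).val := by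
        rw [add_sub_cancel, Units.val_mul, Units.val_mul]
    _ = 1 + q.val * (u.val - 1) := by
        rw [mul_add, mul_one, add_mul, mul_assoc q.val, hcancel, ← Units.val_mul, mul_inv_cancel,
          Units.val_one]

end FixedRowsAndColumns

section Unitriangular

variable {k : Type v} [Field k] {n : ℕ}

lemma IsUnipotentUpper.isUpperTriangular {g : GL (Fin n) k} (hg : IsUnipotentUpper g) :
    g.val.IsUpperTriangular :=
  fun i j hij => (hg i j (le_of_lt hij)).trans (Matrix.one_apply_ne (ne_of_gt hij))

lemma isUnipotentUpper_of_isUpperTriangular {g : GL (Fin n) k} (hg : g.val.IsUpperTriangular)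
    (hdiag : ∀ i, g.val i i = 1) : IsUnipotentUpper g := by
  intro i j hij
  rcases hij.eq_or_lt with rfl | hlt
  · rw [hdiag, Matrix.one_apply_eq]
  · rw [hg hlt, Matrix.one_apply_ne hlt.ne']

lemma mul_apply_diag_of_isUpperTriangular {A B : Matrix (Fin n) (Fin n) k}
    (hA : A.IsUpperTriangular) (hB : B.IsUpperTriangular) (i : Fin n) :
    (A * B) i i = A i i * B i i := by
  rw [Matrix.mul_apply]
  refine Fintype.sum_eq_single i fun m hm => ?_
  rcases hm.lt_or_gt with h | h
  · rw [hA h, zero_mul]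
  · rw [hB h, mul_zero]

/-- The group `U_n` of upper triangular unipotent matrices. -/
def unitriangular (k : Type v) [Field k] (n : ℕ) : Subgroup (GL (Fin n) k) where
  carrier := {g | IsUnipotentUpper g}
  one_mem' _ _ _ := rfl
  mul_mem' {a b} ha hb := by
    refine isUnipotentUpper_of_isUpperTriangular
      (ha.isUpperTriangular.mul hb.isUpperTriangular) fun i => ?_
    rw [Units.val_mul, mul_apply_diag_of_isUpperTriangular ha.isUpperTriangular
      hb.isUpperTriangular, ha i i le_rfl, hb i i le_rfl, Matrix.one_apply_eq, mul_one]
  inv_mem' {a} ha := by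
    have hinv : (a⁻¹).val.IsUpperTriangular := by
      have : Invertible a.val := a.invertible
      rw [Matrix.coe_units_inv]
      exact Matrix.blockTriangular_inv_of_blockTriangular ha.isUpperTriangular
    refine isUnipotentUpper_of_isUpperTriangular hinv fun i => ?_
    have hdiag := mul_apply_diag_of_isUpperTriangular hinv ha.isUpperTriangular i
    rwa [← Units.val_mul, inv_mul_cancel, ha i i le_rfl, Units.val_one, Matrix.one_apply_eq,
      mul_one, eq_comm] at hdiag

lemma mem_unitriangular {g : GL (Fin n) k} : g ∈ unitriangular k n ↔ IsUnipotentUpper g := Iff.rfl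

lemma mul_apply_superdiag {a b : GL (Fin n) k} (ha : a ∈ unitriangular k n)
    (hb : b ∈ unitriangular k n) {i j : Fin n} (hij : (j : ℕ) = i + 1) :
    (a * b).val i j = a.val i j + b.val i j := by
  have hne : i ≠ j := fun h => by subst h; omega
  rw [Units.val_mul, Matrix.mul_apply, Fintype.sum_eq_add i j hne, ha i i le_rfl, hb j j le_rfl,
    Matrix.one_apply_eq, Matrix.one_apply_eq, one_mul, mul_one, add_comm]
  rintro m ⟨hmi, hmj⟩
  rcases hmi.lt_or_gt with h | h
  · rw [ha i m h.le, Matrix.one_apply_ne h.ne', zero_mul]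
  · have hjm : j ≤ m := Fin.le_def.2 (by have := Fin.lt_def.1 h; omega)
    rw [hb m j hjm, Matrix.one_apply_ne hmj, mul_zero]

lemma superdiagSum_mul {a b : GL (Fin n) k} (ha : a ∈ unitriangular k n)
    (hb : b ∈ unitriangular k n) : superdiagSum (a * b) = superdiagSum a + superdiagSum b := by
  simp only [superdiagSum, ← Finset.sum_add_distrib]
  refine Finset.sum_congr rfl fun i _ => Finset.sum_congr rfl fun j _ => ?_
  split_ifs with hij
  · exact mul_apply_superdiag ha hb hij
  · rw [add_zero]

lemma superdiagSum_one : superdiagSum (1 : GL (Fin n) k) = 0 :=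
  Finset.sum_eq_zero fun i _ => Finset.sum_eq_zero fun j _ => by
    split_ifs with hij
    · exact Matrix.one_apply_ne fun h => by subst h; omega
    · rfl

/-- The character `u ↦ ψ (u_{1,2} + ⋯ + u_{n-1,n})` of `U_n`. -/
def whittakerChar {K : Type*} [Field K] (ψ : AddChar k K) : unitriangular k n →* K where
  toFun u := ψ (superdiagSum u.val)
  map_one' := by rw [Subgroup.coe_one, superdiagSum_one, AddChar.map_zero_eq_one]
  map_mul' a b := by
    rw [Subgroup.coe_mul, superdiagSum_mul a.2 b.2, AddChar.map_add_eq_mul]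

/-- The group of upper triangular unipotent matrices whose columns with index at most `c` are those
of the identity. Columns are numbered from `0`, so this is all of `U_n` for `c = 0`. -/
def tailUnitriangular (k : Type v) [Field k] (n c : ℕ) : Subgroup (GL (Fin n) k) :=
  unitriangular k n ⊓ fixColumns k {j | (j : ℕ) ≤ c}

lemma tailUnitriangular_zero : tailUnitriangular k n 0 = unitriangular k n :=
  inf_eq_left.2 fun _ hu j hj i => hu i j (Fin.le_def.2 (le_trans hj i.val.zero_le))

lemma tailUnitriangular_eq_bot {c : ℕ} (hc : n ≤ c + 1) : tailUnitriangular k n c = ⊥ := by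
  refine (Subgroup.eq_bot_iff_forall _).2 fun u hu => ?_
  ext i j
  exact hu.2 j (show (j : ℕ) ≤ c by omega) i

/-- The mirabolic subgroup of `GL_{c+1}(k)`, embedded in the upper left corner of `GL_n(k)`. Its
elements agree with the identity in the rows from `c` on and in the columns after `c`. -/
def mirabolic (k : Type v) [Field k] (c : Fin n) : Subgroup (GL (Fin n) k) :=
  fixRows k (Set.Ici c) ⊓ fixColumns k (Set.Ioi c)

lemma mirabolic_conj_apply {c : Fin n} {q u : GL (Fin n) k} (hq : q ∈ mirabolic k c)
    (hu : u ∈ tailUnitriangular k n c) {i j : Fin n} (hij : j ≤ c ∨ c ≤ i) :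
    (q * u * q⁻¹).val i j = u.val i j := by
  have hqu := conj_val_of_mem (s := Set.Ioi c) (fun i hi => hq.1 i (Set.Ioi_subset_Ici_self hi))
    fun j hj => hu.2 j (Fin.le_def.1 (Set.notMem_Ioi.1 hj))
  rw [hqu, Matrix.add_apply]
  rcases hij with hj | hi
  · rw [hu.2 j hj, add_eq_left, Matrix.mul_apply]
    exact Finset.sum_eq_zero fun m _ => by rw [Matrix.sub_apply, hu.2 j hj, sub_self, mul_zero]
  · rw [mul_apply_of_row_eq_one (hq.1 i hi), Matrix.sub_apply, add_sub_cancel]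

lemma mirabolic_conj_mem {c : Fin n} {q u : GL (Fin n) k} (hq : q ∈ mirabolic k c)
    (hu : u ∈ tailUnitriangular k n c) : q * u * q⁻¹ ∈ tailUnitriangular k n c := by
  refine ⟨fun i j hij => ?_, fun j hj i => ?_⟩
  · rw [mirabolic_conj_apply hq hu ((le_total j c).imp_right hij.trans'), hu.1 i j hij]
  · rw [mirabolic_conj_apply hq hu (Or.inl hj), hu.2 j hj]

lemma superdiagSum_mirabolic_conj {c : Fin n} {q u : GL (Fin n) k} (hq : q ∈ mirabolic k c)
    (hu : u ∈ tailUnitriangular k n c) : superdiagSum (q * u * q⁻¹) = superdiagSum u := by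
  refine Finset.sum_congr rfl fun i _ => Finset.sum_congr rfl fun j _ => ?_
  split_ifs with hij
  · exact mirabolic_conj_apply hq hu (by simp only [Fin.le_def]; omega)
  · rfl

end Unitriangular

section ColumnUnipotent

variable {ι : Type*} [LinearOrder ι] {R : Type*}

/-- The extension by zero of a vector indexed by `Set.Iio c`. -/
def extendByZero [Zero R] {c : ι} (v : Set.Iio c → R) (i : ι) : R :=
  if h : i < c then v ⟨i, h⟩ else 0

lemma extendByZero_coe [Zero R] {c : ι} (v : Set.Iio c → R) (i : Set.Iio c) :
    extendByZero v i = v i := dif_pos i.2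

lemma extendByZero_of_le [Zero R] {c i : ι} (v : Set.Iio c → R) (h : c ≤ i) :
    extendByZero v i = 0 := dif_neg h.not_gt

lemma extendByZero_single [Zero R] {c i : ι} (h : i ∈ Set.Iio c) (z : R) :
    extendByZero (Pi.single ⟨i, h⟩ z) = Pi.single i z := by
  ext m
  by_cases hm : m < c
  · rw [extendByZero, dif_pos hm]
    exact (Pi.single_apply _ _ _).trans
      ((if_congr Subtype.ext_iff rfl rfl).trans (Pi.single_apply _ _ _).symm)
  · rw [extendByZero, dif_neg hm, Pi.single_eq_of_ne]
    rintro rfl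
    exact hm h

lemma extendByZero_add [AddZeroClass R] {c : ι} (v w : Set.Iio c → R) :
    extendByZero (v + w) = extendByZero v + extendByZero w := by
  ext i
  by_cases h : i < c <;> simp [extendByZero, h]

variable [Fintype ι] [CommRing R]

/-- The unipotent matrices with entries `v` above the diagonal in column `c`, and zeros above the
diagonal in the other columns. -/
def columnUnipotent (c : ι) : Multiplicative (Set.Iio c → R) →* GL ι R :=
  MonoidHom.toHomUnits
    { toFun v := 1 + Matrix.vecMulVec (extendByZero v.toAdd) (Pi.single c 1)
      map_one' := by
        ext i j
        simp [extendByZero, Matrix.vecMulVec_apply]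
      map_mul' v w := by
        rw [toAdd_mul, extendByZero_add, Matrix.add_vecMulVec, add_mul, mul_add, mul_add, one_mul,
          mul_one, one_mul, Matrix.vecMulVec_mul_vecMulVec, single_dotProduct,
          extendByZero_of_le _ le_rfl, mul_zero, zero_smul, Matrix.vecMulVec_zero, add_zero]
        abel }

lemma columnUnipotent_val (c : ι) (v : Set.Iio c → R) :
    (columnUnipotent c (.ofAdd v)).val =
      1 + Matrix.vecMulVec (extendByZero v) (Pi.single c 1) := rfl

lemma columnUnipotent_mul_apply (c : ι) (v : Set.Iio c → R) (g : GL ι R) (i j : ι) :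
    (columnUnipotent c (.ofAdd v) * g).val i j = g.val i j + extendByZero v i * g.val c j := by
  rw [Units.val_mul, columnUnipotent_val, add_mul, one_mul, Matrix.vecMulVec_mul,
    Matrix.add_apply, Matrix.vecMulVec_apply, Matrix.single_one_vecMul]
  rfl

lemma columnUnipotent_apply (c : ι) (v : Set.Iio c → R) (i j : ι) :
    (columnUnipotent c (.ofAdd v)).val i j =
      (1 : Matrix ι ι R) i j + extendByZero v i * (1 : Matrix ι ι R) c j := by
  simpa only [mul_one, Units.val_one] using columnUnipotent_mul_apply c v 1 i j

lemma dotProduct_extendByZero (a : ι → R) {c : ι} [Fintype (Set.Iio c)] (w : Set.Iio c → R) :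
    a ⬝ᵥ extendByZero w = (fun i : Set.Iio c => a i) ⬝ᵥ w := by
  classical
  rw [dotProduct, dotProduct, ← Finset.sum_subset (Finset.subset_univ {i | i < c}) fun i _ hi => by
    rw [extendByZero_of_le _ (by simpa using hi), mul_zero]]
  rw [Finset.sum_subtype (p := fun i => i < c) _ (by simp)]
  exact Finset.sum_congr rfl fun i _ => congrArg _ (extendByZero_coe w i)

lemma map_columnUnipotent {S : Type*} [CommRing S] (σ : R →+* S) (c : ι) (v : Set.Iio c → R) :
    Matrix.GeneralLinearGroup.map σ (columnUnipotent c (.ofAdd v)) =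
      columnUnipotent c (.ofAdd (σ ∘ v)) := by
  ext i j
  rw [Matrix.GeneralLinearGroup.map_apply, columnUnipotent_apply, columnUnipotent_apply, map_add,
    map_mul, Matrix.one_apply, Matrix.one_apply]
  simp only [extendByZero, Matrix.one_apply, apply_dite σ, apply_ite σ, map_one, map_zero,
    Function.comp_apply]

lemma exists_columnUnipotent_mul_eq {c : ι} {q : GL ι R} (hq : q ∈ fixRows R (Set.Ici c))
    (v : Set.Iio c → R) : ∃ w, q.val.mulVec (extendByZero w) = extendByZero v ∧
      columnUnipotent c (.ofAdd v) * q = q * columnUnipotent c (.ofAdd w) := by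
  have hrow {g : GL ι R} (hg : g ∈ fixRows R (Set.Ici c)) {i : ι} (hi : c ≤ i) (x : ι → R) :
      (g.val.mulVec x) i = x i := by
    rw [Matrix.mulVec, funext (hg i hi), ← Matrix.mulVec, Matrix.one_mulVec]
  let w : Set.Iio c → R := fun i => (q⁻¹).val.mulVec (extendByZero v) i
  have hw : extendByZero w = (q⁻¹).val.mulVec (extendByZero v) := by
    ext i
    rcases lt_or_ge i c with hi | hi
    · exact extendByZero_coe w ⟨i, hi⟩
    · rw [hrow (inv_mem hq) hi, extendByZero_of_le _ hi, extendByZero_of_le _ hi]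
  have hqw : q.val.mulVec (extendByZero w) = extendByZero v := by
    rw [hw, Matrix.mulVec_mulVec, ← Units.val_mul, mul_inv_cancel, Units.val_one,
      Matrix.one_mulVec]
  refine ⟨w, hqw, Units.ext ?_⟩
  ext i j
  rw [columnUnipotent_mul_apply, hq c le_rfl, Units.val_mul, columnUnipotent_val, mul_add, mul_one,
    Matrix.mul_vecMulVec, hqw, Matrix.add_apply, Matrix.vecMulVec_apply, Matrix.one_apply,
    Pi.single_apply]
  simp only [eq_comm]

end ColumnUnipotent

section ColumnUnipotentGL

variable {k : Type v} [Field k] {n : ℕ}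

lemma columnUnipotent_mem_mirabolic (c : Fin n) (v : Set.Iio c → k) :
    columnUnipotent c (.ofAdd v) ∈ mirabolic k c := by
  refine ⟨fun i hi j => ?_, fun j hj i => ?_⟩
  · rw [columnUnipotent_apply, extendByZero_of_le v hi, zero_mul, add_zero]
  · rw [columnUnipotent_apply, Matrix.one_apply_ne (Set.mem_Ioi.1 hj).ne, mul_zero, add_zero]

lemma columnUnipotent_mem_unitriangular (c : Fin n) (v : Set.Iio c → k) :
    columnUnipotent c (.ofAdd v) ∈ unitriangular k n := by
  intro i j hij
  rw [columnUnipotent_apply, add_eq_left, mul_eq_zero, or_iff_not_imp_right]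
  intro hcj
  rw [Matrix.one_apply, ite_eq_right_iff, not_forall] at hcj
  exact extendByZero_of_le v (hcj.1.trans_le hij)

lemma superdiagSum_columnUnipotent {r c : Fin n} (hc : (c : ℕ) = r + 1) (v : Set.Iio c → k) :
    superdiagSum (columnUnipotent c (.ofAdd v)) = extendByZero v r := by
  have hterm (i j : Fin n) (hij : (j : ℕ) = i + 1) : (columnUnipotent c (.ofAdd v)).val i j =
      if i = r ∧ j = c then extendByZero v r else 0 := by
    rw [columnUnipotent_apply, Matrix.one_apply_ne (by rintro rfl; omega), zero_add,
      Matrix.one_apply]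
    split_ifs <;> grind
  rw [superdiagSum, Finset.sum_eq_single_of_mem r (Finset.mem_univ _),
    Finset.sum_eq_single_of_mem c (Finset.mem_univ _)]
  · rw [if_pos hc, hterm r c hc, if_pos ⟨rfl, rfl⟩]
  · intro j _ hj
    split_ifs with hij
    · rw [hterm r j hij, if_neg fun h => hj h.2]
    · rfl
  · intro i _ hi
    refine Finset.sum_eq_zero fun j _ => ?_
    split_ifs with hij
    · rw [hterm i j hij, if_neg fun h => hi h.1]
    · rfl

lemma columnUnipotent_neg_mul_mem {r c : Fin n} (hc : (c : ℕ) = r + 1) {u : GL (Fin n) k}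
    (hu : u ∈ tailUnitriangular k n r) :
    columnUnipotent c (.ofAdd (-fun i : Set.Iio c => u.val i c)) * u ∈ tailUnitriangular k n c := by
  refine ⟨mul_mem (columnUnipotent_mem_unitriangular _ _) hu.1, fun j hj i => ?_⟩
  rw [columnUnipotent_mul_apply]
  rcases (show j ≤ c from hj).eq_or_lt with rfl | hjc
  · rw [hu.1 j j le_rfl, Matrix.one_apply_eq, mul_one]
    rcases lt_or_ge i j with hij | hij
    · rw [extendByZero_coe _ ⟨i, hij⟩, Pi.neg_apply, add_neg_cancel, Matrix.one_apply_ne hij.ne]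
    · rw [extendByZero_of_le _ hij, add_zero, hu.1 i j hij]
  · rw [hu.1 c j hjc.le, Matrix.one_apply_ne hjc.ne', mul_zero, add_zero,
      hu.2 j (show (j : ℕ) ≤ r by have := Fin.lt_def.1 hjc; omega)]

lemma exists_eq_columnUnipotent_mul {r c : Fin n} (hc : (c : ℕ) = r + 1) {u : GL (Fin n) k}
    (hu : u ∈ tailUnitriangular k n r) :
    ∃ v, ∃ u' ∈ tailUnitriangular k n c, u = columnUnipotent c (.ofAdd v) * u' :=
  ⟨fun i : Set.Iio c => u.val i c, _, columnUnipotent_neg_mul_mem hc hu, by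
    rw [ofAdd_neg, map_inv, mul_inv_cancel_left]⟩

lemma superdiagSum_eq_zero {c : ℕ} {u : GL (Fin n) k} (hu : u ∈ tailUnitriangular k n c)
    (hrows : u ∈ fixRows k {i : Fin n | c ≤ i}) : superdiagSum u = 0 := by
  refine Finset.sum_eq_zero fun i _ => Finset.sum_eq_zero fun j _ => ?_
  split_ifs with hij
  · have hentry : u.val i j = (1 : Matrix (Fin n) (Fin n) k) i j := by
      rcases le_or_gt (j : ℕ) c with hjc | hcj
      · exact hu.2 j hjc i
      · exact hrows i (show c ≤ (i : ℕ) by omega) j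
    rw [hentry, Matrix.one_apply_ne (by rintro rfl; omega)]
  · rfl

lemma exists_mem_mirabolic_row_eq {r c : Fin n} (hr : r < c) {y : Set.Iio c → k} (hy : y ≠ 0) :
    ∃ q ∈ mirabolic k c, (∀ i : Set.Iio c, q.val r i = y i) ∧
      ∀ σ : k →+* k, (∀ i, σ (y i) = y i) → Matrix.GeneralLinearGroup.map σ q = q := by
  obtain ⟨⟨i₀, hi₀⟩, hyi₀⟩ := Function.ne_iff.1 hy
  let z : Fin n → k := extendByZero y
  let A : Matrix (Fin n) (Fin n) k :=
    ((1 : Matrix (Fin n) (Fin n) k).updateRow i₀ z).submatrix (Equiv.swap i₀ r) id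
  have hdet : A.det ≠ 0 := by
    rw [Matrix.det_permute, det_one_updateRow, show z i₀ = y ⟨i₀, hi₀⟩ from dif_pos hi₀]
    exact mul_ne_zero (((Equiv.Perm.sign (Equiv.swap i₀ r)).isUnit.map (Int.castRingHom k)).ne_zero)
      hyi₀
  have hA_row (j : Fin n) : A r j = z j := by simp [A]
  have hA_ne {i : Fin n} (hi : i ≠ r) (j : Fin n) :
      A i j = (1 : Matrix (Fin n) (Fin n) k) (Equiv.swap i₀ r i) j :=
    congrFun (Matrix.updateRow_ne (b := z) fun h => hi <|
      (Equiv.swap i₀ r).injective (h.trans (Equiv.swap_apply_right i₀ r).symm)) j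
  refine ⟨Matrix.GeneralLinearGroup.mkOfDetNeZero A hdet, ⟨fun i hi j => ?_, fun j hj i => ?_⟩,
    fun i => (hA_row i).trans (extendByZero_coe y i), fun σ hσ => ?_⟩
  · have hri : i ≠ r := (hr.trans_le hi).ne'
    exact (hA_ne hri j).trans (by
      rw [Equiv.swap_apply_of_ne_of_ne (lt_of_lt_of_le hi₀ hi).ne' hri])
  · have hj : c < j := hj
    change A i j = _
    rcases eq_or_ne i r with rfl | hi
    · rw [hA_row, Matrix.one_apply_ne (hr.trans hj).ne]
      exact extendByZero_of_le y hj.le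
    · rw [hA_ne hi]
      rcases eq_or_ne i i₀ with rfl | hi'
      · rw [Equiv.swap_apply_left, Matrix.one_apply_ne (hr.trans hj).ne,
          Matrix.one_apply_ne (lt_trans hi₀ hj).ne]
      · rw [Equiv.swap_apply_of_ne_of_ne hi' hi]
  · ext i j
    change σ (A i j) = A i j
    rcases eq_or_ne i r with rfl | hi
    · rw [hA_row]
      by_cases hj : j < c
      · rw [show z j = y ⟨j, hj⟩ from dif_pos hj, hσ]
      · rw [show z j = 0 from dif_neg hj, map_zero]
    · rw [hA_ne hi, Matrix.one_apply, apply_ite σ, map_one, map_zero]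

end ColumnUnipotentGL

section Cuspidal

variable {k : Type v} [Field k] {n m : ℕ}

/-- The unipotent radical of `parabolic k n m`. -/
def unipotentRadical (k : Type v) [Field k] (n m : ℕ) : Subgroup (GL (Fin n) k) :=
  fixRows k {i | m ≤ (i : ℕ)} ⊓ fixColumns k {j | (j : ℕ) < m}

lemma mem_unipotentRadical_iff {g : GL (Fin n) k} :
    g ∈ unipotentRadical k n m ↔ InUnipotentRadical m g := by
  refine ⟨fun hg i j hij => ?_, fun hg => ⟨fun i hi j => hg i j fun h => hi.not_gt h.1,
    fun j hj i => hg i j fun h => h.2.not_gt hj⟩⟩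
  by_cases hi : (i : ℕ) < m
  · exact hg.2 j (show (j : ℕ) < m from not_le.1 fun hj => hij ⟨hi, hj⟩) i
  · exact hg.1 i (not_lt.1 hi) j

lemma apply_eq_zero_of_mem_parabolic {p : GL (Fin n) k} (hp : p ∈ parabolic k n m) {i j : Fin n}
    (hi : m ≤ (i : ℕ)) (hj : (j : ℕ) < m) : p.val i j = 0 := by
  refine hp (?_ : decide (m ≤ (j : ℕ)) < decide (m ≤ (i : ℕ)))
  rw [decide_eq_false hj.not_ge, decide_eq_true hi]
  exact Bool.false_lt_true

lemma conj_mem_unipotentRadical {p u : GL (Fin n) k} (hp : p ∈ parabolic k n m)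
    (hu : u ∈ unipotentRadical k n m) : p * u * p⁻¹ ∈ unipotentRadical k n m := by
  refine ⟨fun i hi j => ?_, fun j hj i => ?_⟩
  · have hrow (s : Fin n) : (p * u).val i s = p.val i s := by
      rw [← mul_one p.val, Units.val_mul, Matrix.mul_apply, Matrix.mul_apply]
      refine Finset.sum_congr rfl fun t _ => ?_
      rcases lt_or_ge (t : ℕ) m with ht | ht
      · rw [apply_eq_zero_of_mem_parabolic hp hi ht, zero_mul, zero_mul]
      · rw [hu.1 t ht]
    rw [Units.val_mul, Matrix.mul_apply]
    simp only [hrow]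
    rw [← Matrix.mul_apply, ← Units.val_mul, mul_inv_cancel, Units.val_one]
  · have hcol (s : Fin n) : (u * p⁻¹).val s j = (p⁻¹).val s j := by
      rw [← one_mul (p⁻¹).val, Units.val_mul, Matrix.mul_apply, Matrix.mul_apply]
      refine Finset.sum_congr rfl fun t _ => ?_
      rcases lt_or_ge (t : ℕ) m with ht | ht
      · rw [hu.2 t ht]
      · rw [apply_eq_zero_of_mem_parabolic (inv_mem hp) ht hj, mul_zero, mul_zero]
    rw [mul_assoc, Units.val_mul, Matrix.mul_apply]
    simp only [hcol]
    rw [← Matrix.mul_apply, ← Units.val_mul, mul_inv_cancel, Units.val_one]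

instance : ((unipotentRadical k n m).subgroupOf (parabolic k n m)).Normal where
  conj_mem _ hu p := conj_mem_unipotentRadical p.2 hu

variable {K : Type w} [Field K] {V : Type u} [AddCommGroup V] [Module K V]
  {ρ : Representation K (GL (Fin n) k) V}

/-- The intertwining map from `ρ` to the representation induced from its coinvariants under the
unipotent radical, given by Frobenius reciprocity. -/
def toCoindCoinvariants (ρ : Representation K (GL (Fin n) k) V) (m : ℕ) :
    ρ.IntertwiningMap (Representation.coind (parabolic k n m).subtype
      (Representation.toCoinvariants (ρ.comp (parabolic k n m).subtype)
        ((unipotentRadical k n m).subgroupOf (parabolic k n m)))) where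
  toLinearMap := LinearMap.codRestrict _
    (LinearMap.pi fun g => Representation.Coinvariants.mk _ ∘ₗ ρ g) fun x p g => by
      simp only [LinearMap.pi_apply, LinearMap.comp_apply, map_mul, Module.End.mul_apply]
      rfl
  isIntertwining' g := by
    refine LinearMap.ext fun x => Subtype.ext (funext fun h => ?_)
    exact congrArg (Representation.Coinvariants.mk _) (LinearMap.congr_fun (map_mul ρ h g) x).symm

lemma IsCuspidal.coinvariants_mk_eq_zero (hρ : IsCuspidal ρ) (hm : 1 ≤ m) (hmn : m < n) (x : V) :
    Representation.Coinvariants.mk ((ρ.comp (parabolic k n m).subtype).comp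
      ((unipotentRadical k n m).subgroupOf (parabolic k n m)).subtype) x = 0 := by
  let N := (unipotentRadical k n m).subgroupOf (parabolic k n m)
  let τ := Representation.toCoinvariants (ρ.comp (parabolic k n m).subtype) N
  have hτ (p : parabolic k n m) (hp : InUnipotentRadical m (p : GL (Fin n) k)) : τ p = 1 :=
    (inferInstance : Representation.IsTrivial (τ.comp N.subtype)).out
      ⟨p, mem_unipotentRadical_iff.2 hp⟩
  have hzero := hρ m hm hmn _ τ hτ (toCoindCoinvariants ρ m)
  have hx : Representation.Coinvariants.mk _ (ρ 1 x) = 0 :=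
    congrFun (congrArg Subtype.val (congrArg (· x) hzero)) 1
  rwa [map_one] at hx

lemma IsCuspidal.eq_zero_of_fixed [Finite k] [CharZero K] (hρ : IsCuspidal ρ) (hm : 1 ≤ m)
    (hmn : m < n) {x : V} (hx : ∀ u ∈ unipotentRadical k n m, ρ u x = x) : x = 0 := by
  let ρN := (ρ.comp (parabolic k n m).subtype).comp
    ((unipotentRadical k n m).subgroupOf (parabolic k n m)).subtype
  let avg := Representation.Coinvariants.lift ρN (charProj ρN 1) fun s =>
    (charProj_mul s).trans (by rw [MonoidHom.one_apply, one_smul])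
  have hfixed : x ∈ charSpace ρN 1 := fun s =>
    (hx s s.2).trans (by rw [MonoidHom.one_apply, one_smul])
  calc x = charProj ρN 1 x := (charProj_apply_of_mem hfixed).symm
    _ = avg (Representation.Coinvariants.mk ρN x) := rfl
    _ = 0 := by rw [hρ.coinvariants_mk_eq_zero hm hmn x, map_zero]

end Cuspidal

section ColumnProjections

variable {k : Type v} [Field k] {K : Type w} [Field K]

/-- The character `v ↦ ψ (y · v)` of the group of vectors with entries in `k`. -/
def dotChar {ι : Type*} [Fintype ι] (ψ : AddChar k K) (y : ι → k) :
    Multiplicative (ι → k) →* K where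
  toFun v := ψ (y ⬝ᵥ v.toAdd)
  map_one' := by rw [toAdd_one, dotProduct_zero, AddChar.map_zero_eq_one]
  map_mul' v w := by rw [toAdd_mul, dotProduct_add, AddChar.map_add_eq_mul]

lemma sum_dotChar_eq_zero {ι : Type*} [Fintype ι] [DecidableEq ι] [Fintype k] {ψ : AddChar k K}
    (hψ : ψ ≠ 1) {v : Multiplicative (ι → k)} (hv : v ≠ 1) : ∑ y : ι → k, dotChar ψ y v = 0 := by
  let dotRight : (ι → k) →+ k := ⟨⟨fun y => y ⬝ᵥ v.toAdd, zero_dotProduct _⟩, fun y z =>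
    add_dotProduct y z _⟩
  refine AddChar.sum_eq_zero_of_ne_one (ψ := ψ.compAddMonoidHom dotRight) fun h => hψ ?_
  obtain ⟨i, hi⟩ := Function.ne_iff.1 (show v.toAdd ≠ 0 from hv)
  ext a
  have ha := DFunLike.congr_fun h (Pi.single i (a / v.toAdd i))
  rwa [AddChar.compAddMonoidHom_apply, show dotRight _ = _ from single_dotProduct _ _ _,
    div_mul_cancel₀ a hi] at ha

variable {n : ℕ} {V : Type u} [AddCommGroup V] [Module K V]

/-- The projection of `V` onto the vectors on which the group of matrices `columnUnipotent c v`
acts through the character `v ↦ ψ (y · v)`. -/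
def columnProj (ρ : Representation K (GL (Fin n) k) V) (ψ : AddChar k K) {c : Fin n}
    (y : Set.Iio c → k) : Module.End K V :=
  charProj (ρ.comp (columnUnipotent c)) (dotChar ψ y)

variable {ρ : Representation K (GL (Fin n) k) V} {ψ : AddChar k K} {c : Fin n}

lemma apply_columnProj [Finite k] (y v : Set.Iio c → k) (x : V) :
    ρ (columnUnipotent c (.ofAdd v)) (columnProj ρ ψ y x) = ψ (y ⬝ᵥ v) • columnProj ρ ψ y x :=
  charProj_apply_mem_charSpace (ρ := ρ.comp (columnUnipotent c)) (χ := dotChar ψ y) x (.ofAdd v)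

lemma sum_columnProj [Fintype k] [CharZero K] (hψ : ψ ≠ 1) :
    ∑ y : Set.Iio c → k, columnProj ρ ψ y = 1 := by
  classical
  simp only [columnProj, charProj_eq_sum]
  rw [← Finset.smul_sum, Finset.sum_comm, Fintype.sum_eq_single 1 fun v hv => by
    rw [← Finset.sum_smul, sum_dotChar_eq_zero hψ (inv_ne_one.2 hv), zero_smul]]
  simp only [inv_one, map_one, one_smul, Finset.sum_const, Finset.card_univ]
  rw [← Nat.cast_smul_eq_nsmul K, smul_smul, Nat.card_eq_fintype_card, Fintype.card_multiplicative,
    inv_mul_cancel₀ (Nat.cast_ne_zero.2 Fintype.card_ne_zero), one_smul]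

lemma apply_columnProj_of_intertwines [Finite k] {σ : k ≃+* k} (hψσ : ∀ a, ψ (σ a) = ψ a)
    {T : Module.End K V}
    (hT : ∀ g x, T (ρ g x) = ρ (Matrix.GeneralLinearGroup.map (σ : k →+* k) g) (T x))
    (y : Set.Iio c → k) (x : V) : T (columnProj ρ ψ y x) = columnProj ρ ψ (σ ∘ y) (T x) := by
  refine apply_charProj_of_intertwines
    (AddEquiv.toMultiplicative (AddEquiv.piCongrRight fun _ => σ.toAddEquiv)) (fun v => ?_)
    (fun v x => ?_) x
  · exact (congrArg ψ (RingHom.map_dotProduct (σ : k →+* k) y v.toAdd)).symm.trans (hψσ _)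
  · exact (hT _ x).trans (by rw [MonoidHom.comp_apply, ← ofAdd_toAdd v, map_columnUnipotent]; rfl)

end ColumnProjections

section WhittakerFiltration

variable {k : Type v} [Field k] {n : ℕ} {K : Type w} [Field K]
  {V : Type u} [AddCommGroup V] [Module K V]

/-- The vectors on which the upper triangular unipotent matrices that agree with the identity in the
columns `0, …, c` act through the character `u ↦ ψ (u_{1,2} + ⋯ + u_{n-1,n})`. For `c = 0` these
are the Whittaker vectors; the spaces grow with `c` and exhaust `V`. -/
def whittakerSpace (ρ : Representation K (GL (Fin n) k) V) (ψ : AddChar k K) (c : ℕ) :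
    Submodule K V where
  carrier := {x | ∀ u ∈ tailUnitriangular k n c, ρ u x = ψ (superdiagSum u) • x}
  zero_mem' _ _ := by rw [map_zero, smul_zero]
  add_mem' hx hy u hu := by rw [map_add, hx u hu, hy u hu, smul_add]
  smul_mem' a x hx u hu := by rw [map_smul, hx u hu, smul_comm]

variable {ρ : Representation K (GL (Fin n) k) V} {ψ : AddChar k K}

lemma mem_whittakerSpace_zero {x : V} : x ∈ whittakerSpace ρ ψ 0 ↔
    x ∈ charSpace (ρ.comp (unitriangular k n).subtype) (whittakerChar ψ) :=
  ⟨fun hx u => hx u (tailUnitriangular_zero.ge u.2),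
    fun hx u hu => hx ⟨u, tailUnitriangular_zero.le hu⟩⟩

lemma whittakerSpace_eq_top {c : ℕ} (hc : n ≤ c + 1) : whittakerSpace ρ ψ c = ⊤ := by
  refine eq_top_iff.2 fun x _ u hu => ?_
  rw [tailUnitriangular_eq_bot hc, Subgroup.mem_bot] at hu
  rw [hu, superdiagSum_one, AddChar.map_zero_eq_one, map_one, one_smul, Module.End.one_apply]

lemma apply_mem_whittakerSpace {c : Fin n} {q : GL (Fin n) k} (hq : q ∈ mirabolic k c) {x : V}
    (hx : x ∈ whittakerSpace ρ ψ c) : ρ q x ∈ whittakerSpace ρ ψ c := by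
  intro u hu
  have hconj : u * q = q * (q⁻¹ * u * q⁻¹⁻¹) := by group
  rw [← Module.End.mul_apply, ← map_mul, hconj, map_mul, Module.End.mul_apply,
    hx _ (mirabolic_conj_mem (inv_mem hq) hu), superdiagSum_mirabolic_conj (inv_mem hq) hu,
    map_smul]

lemma mem_whittakerSpace_of_columnUnipotent {r c : Fin n} (hc : (c : ℕ) = r + 1) {x : V}
    (hx : x ∈ whittakerSpace ρ ψ c)
    (hcol : ∀ v, ρ (columnUnipotent c (.ofAdd v)) x = ψ (extendByZero v r) • x) :
    x ∈ whittakerSpace ρ ψ r := by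
  intro u hu
  obtain ⟨v, u', hu', rfl⟩ := exists_eq_columnUnipotent_mul hc hu
  rw [map_mul, Module.End.mul_apply, hx u' hu', map_smul, hcol, smul_smul, mul_comm,
    superdiagSum_mul (columnUnipotent_mem_unitriangular c v) hu'.1,
    superdiagSum_columnUnipotent hc, AddChar.map_add_eq_mul]

variable [Finite k]

lemma columnProj_mem_whittakerSpace {c : Fin n} (y : Set.Iio c → k) {x : V}
    (hx : x ∈ whittakerSpace ρ ψ c) : columnProj ρ ψ y x ∈ whittakerSpace ρ ψ c :=
  charProj_mem (fun _ => Submodule.smul_mem _ _) (fun _ _ => Submodule.smul_mem _ _)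
    (fun v _ => apply_mem_whittakerSpace (columnUnipotent_mem_mirabolic c v.toAdd)) hx

lemma exists_apply_columnProj_mem_whittakerSpace {r c : Fin n} (hc : (c : ℕ) = r + 1)
    {y : Set.Iio c → k} (hy : y ≠ 0) {x : V} (hx : x ∈ whittakerSpace ρ ψ c) :
    ∃ q : GL (Fin n) k, ρ q (columnProj ρ ψ y x) ∈ whittakerSpace ρ ψ r ∧
      ∀ σ : k →+* k, (∀ i, σ (y i) = y i) → Matrix.GeneralLinearGroup.map σ q = q := by
  obtain ⟨q, hq, hrow, hσ⟩ := exists_mem_mirabolic_row_eq (r := r) (Fin.lt_def.2 (by omega)) hy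
  refine ⟨q, mem_whittakerSpace_of_columnUnipotent hc
    (apply_mem_whittakerSpace hq (columnProj_mem_whittakerSpace y hx)) fun v => ?_, hσ⟩
  obtain ⟨w, hqw, hcomm⟩ := exists_columnUnipotent_mul_eq hq.1 v
  have hentry : extendByZero v r = y ⬝ᵥ w := by
    rw [← hqw, Matrix.mulVec, dotProduct_extendByZero, funext hrow]
  rw [← Module.End.mul_apply, ← map_mul, hcomm, map_mul, Module.End.mul_apply, apply_columnProj,
    map_smul, hentry]

lemma IsCuspidal.columnProj_zero_apply [CharZero K] (hρ : IsCuspidal ρ) {r c : Fin n}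
    (hc : (c : ℕ) = r + 1) {x : V} (hx : x ∈ whittakerSpace ρ ψ c) :
    columnProj ρ ψ (0 : Set.Iio c → k) x = 0 := by
  refine hρ.eq_zero_of_fixed (m := c) (by omega) c.2 fun u hu => ?_
  have hu_tail : u ∈ tailUnitriangular k n r := by
    refine ⟨fun i j hij => ?_, fun j hj => hu.2 j (show (j : ℕ) < c from hc ▸ Nat.lt_succ_of_le hj)⟩
    rcases lt_or_ge (j : ℕ) c with hj | hj
    · exact hu.2 j hj i
    · exact hu.1 i (hj.trans hij) j
  obtain ⟨v, u', hu', rfl⟩ := exists_eq_columnUnipotent_mul hc hu_tail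
  have hrows : u' ∈ fixRows k {i : Fin n | (c : ℕ) ≤ i} :=
    (Subgroup.mul_mem_cancel_left _ (columnUnipotent_mem_mirabolic c v).1).1 hu.1
  rw [map_mul, Module.End.mul_apply, columnProj_mem_whittakerSpace 0 hx u' hu',
    superdiagSum_eq_zero hu' hrows, AddChar.map_zero_eq_one, one_smul, apply_columnProj,
    zero_dotProduct, AddChar.map_zero_eq_one, one_smul]

end WhittakerFiltration

section TameSubmodules

variable {k : Type v} [Field k] {n : ℕ} {K : Type w} [Field K]
  {V : Type u} [AddCommGroup V] [Module K V] {R : Type*} [CommRing R] [Module R V]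

/-- Submodules stable under the group, under multiplication by the values of `ψ` and under division
by the order of `k`. They are stable under the projections `columnProj ρ ψ y`, so they decompose in
the same way as `V` itself. -/
structure IsTameSubmodule (ρ : Representation K (GL (Fin n) k) V) (ψ : AddChar k K)
    (L : Submodule R V) : Prop where
  apply_mem : ∀ g, ∀ x ∈ L, ρ g x ∈ L
  smul_mem : ∀ a, ∀ x ∈ L, ψ a • x ∈ L
  inv_card_smul_mem : ∀ x ∈ L, (Nat.card k : K)⁻¹ • x ∈ L

variable {ρ : Representation K (GL (Fin n) k) V} {ψ : AddChar k K} {L : Submodule R V}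

lemma isTameSubmodule_top : IsTameSubmodule ρ ψ (⊤ : Submodule K V) :=
  ⟨fun _ _ _ => trivial, fun _ _ _ => trivial, fun _ _ => trivial⟩

lemma IsTameSubmodule.columnProj_mem [Algebra R K] [IsScalarTower R K V] [Finite k]
    (hL : IsTameSubmodule ρ ψ L) {c : Fin n} (y : Set.Iio c → k) {x : V} (hx : x ∈ L) :
    columnProj ρ ψ y x ∈ L := by
  refine charProj_mem (fun x hx => ?_) (fun v => hL.smul_mem (y ⬝ᵥ v.toAdd))
    (fun v => hL.apply_mem (columnUnipotent c v)) hx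
  have hpow (d : ℕ) : ((Nat.card k : K)⁻¹ ^ d) • x ∈ L := by
    induction d with
    | zero => rwa [pow_zero, one_smul]
    | succ d ih => rw [pow_succ', mul_smul]; exact hL.inv_card_smul_mem _ ih
  rw [Nat.card_congr Multiplicative.toAdd, Nat.card_fun, Nat.cast_pow, ← inv_pow]
  exact hpow _

theorem IsCuspidal.le_of_inf_whittakerSpace_le [CharZero K] [Algebra R K] [IsScalarTower R K V]
    [Finite k] (hρ : IsCuspidal ρ) (hψ : ψ ≠ 1) (hL : IsTameSubmodule ρ ψ L) {L' : Submodule R V}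
    (hL' : ∀ g, ∀ x ∈ L', ρ g x ∈ L')
    (hWL : ∀ x ∈ L, x ∈ whittakerSpace ρ ψ 0 → x ∈ L') : L ≤ L' := by
  have := Fintype.ofFinite k
  suffices h : ∀ c : ℕ, ∀ x ∈ L, x ∈ whittakerSpace ρ ψ c → x ∈ L' from fun x hx =>
    h n x hx ((whittakerSpace_eq_top n.le_succ).ge trivial)
  intro c
  induction c with
  | zero => exact hWL
  | succ r ih =>
    intro x hx hxW
    rcases lt_or_ge (r + 1) n with hr | hr
    · let r' : Fin n := ⟨r, by omega⟩
      let c : Fin n := ⟨r + 1, hr⟩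
      have hsum : ∑ y : Set.Iio c → k, columnProj ρ ψ y x = x := by
        rw [← LinearMap.sum_apply, sum_columnProj hψ, Module.End.one_apply]
      rw [← hsum]
      refine L'.sum_mem fun y _ => ?_
      rcases eq_or_ne y 0 with rfl | hy
      · rw [hρ.columnProj_zero_apply (r := r') (c := c) rfl hxW]
        exact L'.zero_mem
      · obtain ⟨q, hq, -⟩ :=
          exists_apply_columnProj_mem_whittakerSpace (r := r') (c := c) rfl hy hxW
        simpa only [Representation.inv_self_apply] using
          hL' q⁻¹ _ (ih _ (hL.apply_mem q _ (hL.columnProj_mem y hx)) hq)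
    · exact ih x hx ((whittakerSpace_eq_top hr).ge trivial)

lemma IsCuspidal.exists_mem_whittakerSpace_ne_zero [CharZero K] [Finite k] [Nontrivial V]
    (hρ : IsCuspidal ρ) (hψ : ψ ≠ 1) : ∃ x ∈ whittakerSpace ρ ψ 0, x ≠ 0 := by
  by_contra! h
  refine top_ne_bot (α := Submodule K V) (le_bot_iff.1 ?_)
  refine hρ.le_of_inf_whittakerSpace_le hψ isTameSubmodule_top (fun g x hx => ?_) fun x _ hx => ?_
  · rw [(Submodule.mem_bot K).1 hx, map_zero]
    exact zero_mem _
  · exact (Submodule.mem_bot K).2 (h x hx)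

end TameSubmodules

section NormalizedIntertwiners

variable {k : Type v} [Field k] {n : ℕ} {K : Type w} [Field K]
  {V : Type u} [AddCommGroup V] [Module K V] {l : ℕ} {σ : k ≃+* k}
  {ρ : Representation K (GL (Fin n) k) V} {ψ : AddChar k K} {T : Module.End K V}

/-- `T` is an isomorphism from `ρ` to its twist by the automorphism `σ`, with `T ^ l = 1`,
normalized by the requirement that it fixes the Whittaker vectors. -/
structure IsNormalizedIntertwiner (l : ℕ) (σ : k ≃+* k) (ρ : Representation K (GL (Fin n) k) V)
    (ψ : AddChar k K) (T : Module.End K V) : Prop where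
  intertwines : ∀ g x,
    T (ρ g x) = ρ (Matrix.GeneralLinearGroup.map (σ : k →+* k) g) (T x)
  pow_eq_one : T ^ l = 1
  normalized : ∀ x ∈ whittakerSpace ρ ψ 0, T x = x

lemma iterate_map_eq (hσ : ∀ a, σ^[l] a = a) (g : GL (Fin n) k) :
    (Matrix.GeneralLinearGroup.map (σ : k →+* k))^[l] g = g := by
  ext i j
  have hentry : Function.Semiconj (fun g : GL (Fin n) k => g.val i j)
      (Matrix.GeneralLinearGroup.map (σ : k →+* k)) σ := fun _ => rfl
  exact (hentry.iterate_right l g).trans (hσ _)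

lemma iterate_comp_eq {ι : Type*} (hσ : ∀ a, σ^[l] a = a) (y : ι → k) : (σ ∘ ·)^[l] y = y := by
  ext i
  have hentry : Function.Semiconj (fun y : ι → k => y i) (σ ∘ ·) σ := fun _ => rfl
  exact (hentry.iterate_right l y).trans (hσ _)

variable {R : Type*} [CommRing R] [Algebra R K] [Module R V] [IsScalarTower R K V]
  {L : Submodule R V}

lemma IsNormalizedIntertwiner.mem_map_one_sub_of_apply_mem
    (hT : IsNormalizedIntertwiner l σ ρ ψ T) (hL : ∀ g, ∀ x ∈ L, ρ g x ∈ L) {q : GL (Fin n) k}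
    (hq : Matrix.GeneralLinearGroup.map (σ : k →+* k) q = q) {x : V}
    (hx : ρ q x ∈ L.map (1 - T.restrictScalars R)) : x ∈ L.map (1 - T.restrictScalars R) := by
  obtain ⟨z, hz, hzx⟩ := hx
  refine ⟨ρ q⁻¹ z, hL _ _ hz, ?_⟩
  calc ρ q⁻¹ z - T (ρ q⁻¹ z) = ρ q⁻¹ (z - T z) := by
        rw [hT.intertwines, map_inv (Matrix.GeneralLinearGroup.map (σ : k →+* k)), hq, map_sub]
    _ = x := by rw [show z - T z = ρ q x from hzx, Representation.inv_self_apply]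

variable [Finite k]

lemma IsNormalizedIntertwiner.commute_apply_mul_columnProj
    (hT : IsNormalizedIntertwiner l σ ρ ψ T) (hψσ : ∀ a, ψ (σ a) = ψ a) {c : Fin n}
    {y : Set.Iio c → k} (hy : σ ∘ y = y) {q : GL (Fin n) k}
    (hq : Matrix.GeneralLinearGroup.map (σ : k →+* k) q = q) :
    Commute (ρ q * columnProj ρ ψ y) T := by
  refine LinearMap.ext fun x => ?_
  rw [Module.End.mul_apply, Module.End.mul_apply, Module.End.mul_apply, Module.End.mul_apply,
    hT.intertwines, hq, apply_columnProj_of_intertwines hψσ hT.intertwines, hy]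

variable [CharZero K]

lemma IsCuspidal.isNormalizedIntertwiner_of_normalized (hρ : IsCuspidal ρ) (hψ : ψ ≠ 1)
    (hσ : ∀ a, σ^[l] a = a)
    (hT : ∀ g x, T (ρ g x) = ρ (Matrix.GeneralLinearGroup.map (σ : k →+* k) g) (T x))
    (hTW : ∀ x ∈ whittakerSpace ρ ψ 0, T x = x) : IsNormalizedIntertwiner l σ ρ ψ T := by
  refine ⟨hT, LinearMap.ext fun x => ?_, hTW⟩
  refine hρ.le_of_inf_whittakerSpace_le (L' := LinearMap.eqLocus (T ^ l) 1) hψ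
    isTameSubmodule_top (fun g x hx => ?_) (fun x _ hx => ?_) (Submodule.mem_top (x := x))
  · rw [LinearMap.mem_eqLocus] at hx ⊢
    rw [pow_apply_of_semiconj hT, iterate_map_eq hσ, hx, Module.End.one_apply, Module.End.one_apply]
  · rw [LinearMap.mem_eqLocus, Module.End.pow_apply, Function.iterate_fixed (hTW x hx),
      Module.End.one_apply]

lemma IsCuspidal.isNormalizedIntertwiner_unique (hρ : IsCuspidal ρ) (hψ : ψ ≠ 1)
    {T' : Module.End K V} (hT : IsNormalizedIntertwiner l σ ρ ψ T)
    (hT' : IsNormalizedIntertwiner l σ ρ ψ T') : T = T' := by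
  refine LinearMap.ext fun x => ?_
  refine hρ.le_of_inf_whittakerSpace_le (L' := LinearMap.eqLocus T T') hψ
    isTameSubmodule_top (fun g x hx => ?_) (fun x _ hx => ?_) (Submodule.mem_top (x := x))
  · rw [LinearMap.mem_eqLocus] at hx ⊢
    rw [hT.intertwines, hT'.intertwines, hx]
  · rw [LinearMap.mem_eqLocus, hT.normalized x hx, hT'.normalized x hx]

lemma IsNormalizedIntertwiner.apply_mem (hT : IsNormalizedIntertwiner l σ ρ ψ T)
    (hρ : IsCuspidal ρ) (hψ : ψ ≠ 1) (hL : IsTameSubmodule ρ ψ L) {x : V} (hx : x ∈ L) :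
    T x ∈ L := by
  refine hρ.le_of_inf_whittakerSpace_le (L' := L.comap (T.restrictScalars R)) hψ hL
    (fun g x hx => ?_) (fun x hx hxW => ?_) hx
  · exact (congrArg (· ∈ L) (hT.intertwines g x)).mpr (hL.apply_mem _ _ hx)
  · exact (congrArg (· ∈ L) (hT.normalized x hxW)).mpr hx

lemma IsNormalizedIntertwiner.mem_map_one_sub (hT : IsNormalizedIntertwiner l σ ρ ψ T)
    (hl : l.Prime) (hρ : IsCuspidal ρ) (hψ : ψ ≠ 1) (hψσ : ∀ a, ψ (σ a) = ψ a)
    (hσ : ∀ a, σ^[l] a = a) (hL : IsTameSubmodule ρ ψ L) (c : ℕ) {x : V} (hx : x ∈ L)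
    (hxW : x ∈ whittakerSpace ρ ψ c) (hnorm : tateNorm l (T.restrictScalars R) x = 0) :
    x ∈ L.map (1 - T.restrictScalars R) := by
  have := Fintype.ofFinite k
  induction c generalizing x with
  | zero =>
    have hfix : T.restrictScalars R x = x := hT.normalized x hxW
    rw [tateNorm_apply_of_fixed hfix, ← Nat.cast_smul_eq_nsmul K] at hnorm
    rw [(smul_eq_zero.1 hnorm).resolve_left (Nat.cast_ne_zero.2 hl.ne_zero)]
    exact zero_mem _
  | succ r ih =>
    rcases lt_or_ge (r + 1) n with hr | hr
    · let r' : Fin n := ⟨r, by omega⟩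
      let c : Fin n := ⟨r + 1, hr⟩
      refine mem_map_one_sub_of_fixed hl (fun x => hT.apply_mem hρ hψ hL)
        (P := fun y : Set.Iio c → k => (columnProj ρ ψ y).restrictScalars R)
        (iterate_comp_eq hσ) ?_ (apply_columnProj_of_intertwines hψσ hT.intertwines)
        (fun y x => hL.columnProj_mem y) hx hnorm fun y hy => ?_
      · refine LinearMap.ext fun x => ?_
        have hsum := LinearMap.congr_fun (sum_columnProj (ρ := ρ) (c := c) hψ) x
        rw [LinearMap.sum_apply] at hsum ⊢
        exact hsum
      · rcases eq_or_ne y 0 with rfl | hy0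
        · rw [LinearMap.restrictScalars_apply,
            hρ.columnProj_zero_apply (r := r') (c := c) rfl hxW]
          exact zero_mem _
        · obtain ⟨q, hqW, hqσ⟩ :=
            exists_apply_columnProj_mem_whittakerSpace (r := r') (c := c) rfl hy0 hxW
          have hq := hqσ σ fun i => congrFun hy i
          have hcomm : Commute ((ρ q * columnProj ρ ψ y).restrictScalars R)
              (T.restrictScalars R) := LinearMap.ext fun x =>
            LinearMap.congr_fun (hT.commute_apply_mul_columnProj hψσ hy hq).eq x
          refine hT.mem_map_one_sub_of_apply_mem hL.apply_mem hq
            (ih (hL.apply_mem q _ (hL.columnProj_mem y hx)) hqW ?_)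
          exact (tateNorm_apply_of_commute hcomm x).trans (by rw [hnorm, map_zero])
    · exact ih hx ((whittakerSpace_eq_top hr).ge trivial) hnorm

end NormalizedIntertwiners

section Antitranspose

variable {k : Type v} [Field k] {n : ℕ}

/-- The reflection of a matrix in its antidiagonal, an anti-automorphism of `GL_n(k)`. -/
def antitranspose (g : GL (Fin n) k) : GL (Fin n) k where
  val := g.val.transpose.submatrix Fin.rev Fin.rev
  inv := (g⁻¹).val.transpose.submatrix Fin.rev Fin.rev
  val_inv := by
    rw [← Matrix.submatrix_mul _ _ _ _ _ Fin.rev_bijective, ← Matrix.transpose_mul,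
      ← Units.val_mul, inv_mul_cancel, Units.val_one, Matrix.transpose_one]
    exact Matrix.submatrix_one _ Fin.rev_injective
  inv_val := by
    rw [← Matrix.submatrix_mul _ _ _ _ _ Fin.rev_bijective, ← Matrix.transpose_mul,
      ← Units.val_mul, mul_inv_cancel, Units.val_one, Matrix.transpose_one]
    exact Matrix.submatrix_one _ Fin.rev_injective

lemma antitranspose_apply (g : GL (Fin n) k) (i j : Fin n) :
    (antitranspose g).val i j = g.val j.rev i.rev := rfl

lemma antitranspose_involutive : Function.Involutive (antitranspose (k := k) (n := n)) := by
  intro g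
  ext i j
  rw [antitranspose_apply, antitranspose_apply, Fin.rev_rev, Fin.rev_rev]

lemma antitranspose_mul (g h : GL (Fin n) k) :
    antitranspose (g * h) = antitranspose h * antitranspose g := by
  refine Units.ext ?_
  change (g.val * h.val).transpose.submatrix Fin.rev Fin.rev = _
  rw [Matrix.transpose_mul, Matrix.submatrix_mul _ _ _ _ _ Fin.rev_bijective]
  rfl

lemma antitranspose_mem_unitriangular {u : GL (Fin n) k} (hu : u ∈ unitriangular k n) :
    antitranspose u ∈ unitriangular k n := by
  intro i j hij
  rw [antitranspose_apply, hu _ _ (Fin.rev_le_rev.2 hij), Matrix.one_apply, Matrix.one_apply]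
  simp only [Fin.rev_inj, eq_comm]

lemma superdiagSum_antitranspose (u : GL (Fin n) k) :
    superdiagSum (antitranspose u) = superdiagSum u := by
  rw [superdiagSum, superdiagSum, Finset.sum_comm, ← Equiv.sum_comp Fin.revPerm]
  refine Finset.sum_congr rfl fun i _ => ?_
  rw [← Equiv.sum_comp Fin.revPerm]
  refine Finset.sum_congr rfl fun j _ => ?_
  simp only [Fin.revPerm_apply, antitranspose_apply, Fin.rev_rev, Fin.val_rev]
  exact if_congr (by omega) rfl rfl

end Antitranspose

section Pivots

variable {k : Type v} [Field k] {n : ℕ}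

/-- The entry of `g` at `(i, j)` is the only nonzero one in its row and the only nonzero one in its
column. -/
structure IsPivot (g : GL (Fin n) k) (i j : Fin n) : Prop where
  ne_zero : g.val i j ≠ 0
  row : ∀ j' ≠ j, g.val i j' = 0
  column : ∀ i' ≠ i, g.val i' j = 0

/-- A monomial matrix: every row, and then also every column, has exactly one nonzero entry. -/
def IsMonomial (g : GL (Fin n) k) : Prop :=
  ∀ i, ∃ j, IsPivot g i j

lemma exists_apply_ne_zero (g : GL (Fin n) k) (i : Fin n) : ∃ j, g.val i j ≠ 0 := by
  by_contra! h
  exact Matrix.GeneralLinearGroup.det_ne_zero g (Matrix.det_eq_zero_of_row_eq_zero i h)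

lemma IsPivot.antitranspose {g : GL (Fin n) k} {i j : Fin n} (h : IsPivot g i j) :
    IsPivot (antitranspose g) j.rev i.rev where
  ne_zero := by rw [antitranspose_apply, Fin.rev_rev, Fin.rev_rev]; exact h.ne_zero
  row j' hj' := by
    rw [antitranspose_apply, Fin.rev_rev]
    exact h.column _ fun h' => hj' (Fin.rev_eq_iff.1 h')
  column i' hi' := by
    rw [antitranspose_apply, Fin.rev_rev]
    exact h.row _ fun h' => hi' (Fin.rev_eq_iff.1 h')

lemma IsMonomial.exists_perm {g : GL (Fin n) k} (hg : IsMonomial g) :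
    ∃ p : Equiv.Perm (Fin n), ∀ i, IsPivot g i (p i) := by
  choose p hp using hg
  have hinj : Function.Injective p := fun i i' hii' => by
    by_contra hne
    exact (hp i).ne_zero ((congrArg _ hii').trans ((hp i').column i hne))
  exact ⟨Equiv.ofBijective p (Finite.injective_iff_bijective.1 hinj), hp⟩

lemma IsMonomial.antitranspose {g : GL (Fin n) k} (hg : IsMonomial g) :
    IsMonomial (antitranspose g) := by
  obtain ⟨p, hp⟩ := hg.exists_perm
  intro i
  have hi := (hp (p.symm i.rev)).antitranspose
  rw [Equiv.apply_symm_apply, Fin.rev_rev] at hi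
  exact ⟨_, hi⟩

lemma exists_unitriangular_mul_apply_eq_zero {g : GL (Fin n) k} {r j : Fin n}
    (hrj : g.val r j ≠ 0) :
    ∃ a ∈ unitriangular k n, (∀ i, r ≤ i → ∀ m, (a * g).val i m = g.val i m) ∧
      (∀ i < r, (a * g).val i j = 0) ∧
      ∀ i₀ ≠ r, ∀ j₀, IsPivot g i₀ j₀ → IsPivot (a * g) i₀ j₀ := by
  let v : Set.Iio r → k := fun i => -(g.val i j / g.val r j)
  have hrow {i : Fin n} (hi : r ≤ i) (m : Fin n) :
      (columnUnipotent r (.ofAdd v) * g).val i m = g.val i m := by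
    rw [columnUnipotent_mul_apply, extendByZero_of_le _ hi, zero_mul, add_zero]
  refine ⟨columnUnipotent r (.ofAdd v), columnUnipotent_mem_unitriangular _ _,
    fun i hi => hrow hi, fun i hi => ?_, fun i₀ hi₀ j₀ h₀ => ?_⟩
  · rw [columnUnipotent_mul_apply, extendByZero_coe v ⟨i, hi⟩, neg_mul, div_mul_cancel₀ _ hrj,
      add_neg_cancel]
  · have hrj₀ : g.val r j₀ = 0 := h₀.column r hi₀.symm
    have hi₀j : g.val i₀ j = 0 := h₀.row j fun h => hrj (h ▸ hrj₀)
    have hv : extendByZero v i₀ = 0 := by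
      rcases lt_or_ge i₀ r with hi | hi
      · exact (extendByZero_coe v ⟨i₀, hi⟩).trans (by simp only [v, hi₀j, zero_div, neg_zero])
      · exact extendByZero_of_le v hi
    have hrow₀ (m : Fin n) : (columnUnipotent r (.ofAdd v) * g).val i₀ m = g.val i₀ m := by
      rw [columnUnipotent_mul_apply, hv, zero_mul, add_zero]
    refine ⟨by rw [hrow₀]; exact h₀.ne_zero, fun m hm => (hrow₀ m).trans (h₀.row m hm),
      fun i hi => ?_⟩
    rw [columnUnipotent_mul_apply, hrj₀, mul_zero, add_zero, h₀.column i hi]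

lemma exists_mul_unitriangular_apply_eq_zero {g : GL (Fin n) k} {r j : Fin n}
    (hrj : g.val r j ≠ 0) :
    ∃ b ∈ unitriangular k n, (∀ m ≤ j, ∀ i, (g * b).val i m = g.val i m) ∧
      (∀ m, j < m → (g * b).val r m = 0) ∧
      ∀ j₀ ≠ j, ∀ i₀, IsPivot g i₀ j₀ → IsPivot (g * b) i₀ j₀ := by
  obtain ⟨a, ha, hrow, hzero, hpivot⟩ := exists_unitriangular_mul_apply_eq_zero
    (g := antitranspose g) (r := j.rev) (j := r.rev) (by
      rw [antitranspose_apply, Fin.rev_rev, Fin.rev_rev]; exact hrj)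
  have hflip : g * antitranspose a = antitranspose (a * antitranspose g) := by
    rw [antitranspose_mul, antitranspose_involutive]
  refine ⟨antitranspose a, antitranspose_mem_unitriangular ha, fun m hm i => ?_, fun m hm => ?_,
    fun j₀ hj₀ i₀ h₀ => ?_⟩
  · rw [hflip, antitranspose_apply, hrow _ (Fin.rev_le_rev.2 hm), antitranspose_apply,
      Fin.rev_rev, Fin.rev_rev]
  · rw [hflip, antitranspose_apply, hzero _ (Fin.rev_lt_rev.2 hm)]
  · have h := (hpivot j₀.rev (Fin.rev_injective.ne hj₀) i₀.rev h₀.antitranspose).antitranspose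
    rwa [← hflip, Fin.rev_rev, Fin.rev_rev] at h

lemma exists_isPivot_unitriangular_mul_mul {r : Fin n} {g : GL (Fin n) k}
    (hg : ∀ i, r < i → ∃ j, IsPivot g i j) :
    ∃ a ∈ unitriangular k n, ∃ b ∈ unitriangular k n,
      ∀ i, r ≤ i → ∃ j, IsPivot (a * g * b) i j := by
  obtain ⟨j, hrj, hmin⟩ := WellFounded.has_min wellFounded_lt {j | g.val r j ≠ 0}
    (exists_apply_ne_zero g r)
  obtain ⟨a, ha, hrow, hzero, hpivot_a⟩ := exists_unitriangular_mul_apply_eq_zero hrj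
  obtain ⟨b, hb, hcolumn, hzero_row, hpivot_b⟩ := exists_mul_unitriangular_apply_eq_zero
    (g := a * g) (r := r) (j := j) (by rw [hrow r le_rfl]; exact hrj)
  have hne {i j₀ : Fin n} (hi : r < i) (h₀ : IsPivot g i j₀) : j₀ ≠ j := fun h =>
    hrj (h ▸ h₀.column r hi.ne)
  refine ⟨a, ha, b, hb, fun i hi => ?_⟩
  rcases hi.lt_or_eq with hi | rfl
  · obtain ⟨j₀, h₀⟩ := hg i hi
    exact ⟨j₀, hpivot_b j₀ (hne hi h₀) i (hpivot_a i hi.ne' j₀ h₀)⟩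
  · refine ⟨j, by rw [hcolumn j le_rfl, hrow r le_rfl]; exact hrj, fun m hm => ?_, fun i hi => ?_⟩
    · rcases hm.lt_or_gt with hm | hm
      · rw [hcolumn m hm.le, hrow r le_rfl]
        exact not_not.1 fun h => hmin m h hm
      · exact hzero_row m hm
    · rw [hcolumn j le_rfl]
      rcases hi.lt_or_gt with hi | hi
      · exact hzero i hi
      · obtain ⟨j₀, h₀⟩ := hg i hi
        rw [hrow i hi.le, h₀.row j (hne hi h₀).symm]

theorem exists_isMonomial_unitriangular_mul_mul (g : GL (Fin n) k) :
    ∃ a ∈ unitriangular k n, ∃ b ∈ unitriangular k n, IsMonomial (a * g * b) := by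
  suffices ∀ (r : ℕ) (g : GL (Fin n) k), (∀ i : Fin n, r ≤ i → ∃ j, IsPivot g i j) →
      ∃ a ∈ unitriangular k n, ∃ b ∈ unitriangular k n, IsMonomial (a * g * b) from
    this n g fun i hi => absurd i.2 hi.not_gt
  intro r
  induction r with
  | zero =>
    intro g hg
    refine ⟨1, one_mem _, 1, one_mem _, fun i => ?_⟩
    rw [one_mul, mul_one]
    exact hg i i.val.zero_le
  | succ r ih =>
    intro g hg
    rcases lt_or_ge r n with hr | hr
    · obtain ⟨a, ha, b, hb, hab⟩ :=
        exists_isPivot_unitriangular_mul_mul (r := ⟨r, hr⟩) fun i hi => hg i hi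
      obtain ⟨a', ha', b', hb', h⟩ := ih _ fun i hi => hab i hi
      refine ⟨a' * a, mul_mem ha' ha, b * b', mul_mem hb hb', ?_⟩
      simpa only [mul_assoc] using h
    · exact ih g fun i hi => absurd i.2 (by omega)

lemma columnUnipotent_single_val {c i : Fin n} (h : i ∈ Set.Iio c) (z : k) :
    (columnUnipotent c (.ofAdd (Pi.single ⟨i, h⟩ z))).val = 1 + Matrix.single i c z := by
  rw [columnUnipotent_val, extendByZero_single]
  congr 1
  ext a b
  rw [Matrix.vecMulVec_apply, Matrix.single_apply, Pi.single_apply, Pi.single_apply, mul_ite,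
    mul_one, mul_zero, ← ite_and]
  exact if_congr (by tauto) rfl rfl

lemma superdiagSum_columnUnipotent_single {c i : Fin n} (h : i ∈ Set.Iio c) (z : k) :
    superdiagSum (columnUnipotent c (.ofAdd (Pi.single ⟨i, h⟩ z))) =
      (if (c : ℕ) = i + 1 then 1 else 0) * z := by
  have hlt := Fin.lt_def.1 (Set.mem_Iio.1 h)
  rw [superdiagSum_columnUnipotent (r := ⟨c - 1, by omega⟩) (by simp only; omega),
    extendByZero_single, Pi.single_apply, ite_mul, one_mul, zero_mul]
  exact if_congr (by rw [Fin.ext_iff]; simp only; omega) rfl rfl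

lemma IsPivot.mul_columnUnipotent_single {g : GL (Fin n) k} {i m a b : Fin n} (hi : IsPivot g i a)
    (hm : IsPivot g m b) (him : i ∈ Set.Iio m) (hab : a ∈ Set.Iio b) (z : k) :
    g * columnUnipotent b (.ofAdd (Pi.single ⟨a, hab⟩ z)) =
      columnUnipotent m (.ofAdd (Pi.single ⟨i, him⟩ (g.val i a / g.val m b * z))) * g := by
  refine Units.ext ?_
  rw [Units.val_mul, Units.val_mul, columnUnipotent_single_val, columnUnipotent_single_val, mul_add,
    add_mul, mul_one, one_mul, add_right_inj]
  ext s t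
  by_cases hs : s = i <;> by_cases ht : t = b
  · subst hs ht
    rw [Matrix.mul_single_apply_same, Matrix.single_mul_apply_same, mul_right_comm,
      div_mul_cancel₀ _ hm.ne_zero]
  · subst hs
    rw [Matrix.mul_single_apply_of_ne _ _ _ _ _ ht, Matrix.single_mul_apply_same, hm.row t ht,
      mul_zero]
  · subst ht
    rw [Matrix.mul_single_apply_same, Matrix.single_mul_apply_of_ne _ _ _ _ _ hs, hi.column s hs,
      zero_mul]
  · rw [Matrix.mul_single_apply_of_ne _ _ _ _ _ ht, Matrix.single_mul_apply_of_ne _ _ _ _ _ hs]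

end Pivots

section MultiplicityOne

lemma extendDomain_equivSubtype_apply {n : ℕ} (q : Equiv.Perm (Fin n)) (i : Fin n) :
    q.extendDomain Fin.equivSubtype (i : ℕ) = q i :=
  Equiv.Perm.extendDomain_apply_image q Fin.equivSubtype i

lemma exists_descent_of_extendDomain_lt {n : ℕ} (q : Equiv.Perm (Fin n)) {i : ℕ}
    (h : q.extendDomain Fin.equivSubtype (i + 1) < q.extendDomain Fin.equivSubtype i) :
    ∃ a b : Fin n, (a : ℕ) = i ∧ (b : ℕ) = i + 1 ∧ q b < q a := by
  have happly_of_le {i : ℕ} (hi : n ≤ i) : q.extendDomain Fin.equivSubtype i = i :=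
    Equiv.Perm.extendDomain_apply_not_subtype q Fin.equivSubtype hi.not_gt
  rcases lt_or_ge (i + 1) n with hi | hi
  · let a : Fin n := ⟨i, by omega⟩
    let b : Fin n := ⟨i + 1, hi⟩
    have ha := extendDomain_equivSubtype_apply q a
    have hb := extendDomain_equivSubtype_apply q b
    exact ⟨a, b, rfl, rfl, Fin.lt_def.2 (ha ▸ hb ▸ h)⟩
  · rw [happly_of_le hi] at h
    rcases lt_or_ge i n with hin | hin
    · have ha := extendDomain_equivSubtype_apply q ⟨i, hin⟩
      dsimp only at ha
      omega
    · rw [happly_of_le hin] at h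
      omega

lemma hasUnitDescents_extendDomain {n : ℕ} {q : Equiv.Perm (Fin n)}
    (hq : ∀ i m : Fin n, (m : ℕ) = i + 1 → q m < q i → (q m : ℕ) + 1 = q i) :
    HasUnitDescents (q.extendDomain Fin.equivSubtype) := by
  intro i hdesc
  obtain ⟨a, b, rfl, hb, hqba⟩ := exists_descent_of_extendDomain_lt q hdesc
  rw [← hb, extendDomain_equivSubtype_apply, extendDomain_equivSubtype_apply]
  exact hq a b hb hqba

lemma involutive_of_unit_descents {n : ℕ} {q : Equiv.Perm (Fin n)}
    (hq : ∀ i m : Fin n, (m : ℕ) = i + 1 → q m < q i → (q m : ℕ) + 1 = q i) :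
    Function.Involutive q := by
  intro i
  have hi := (hasUnitDescents_extendDomain hq).involutive (Equiv.bijective _) i
  rw [extendDomain_equivSubtype_apply, extendDomain_equivSubtype_apply] at hi
  exact Fin.ext hi

lemma apply_eq_of_unit_descents {n : ℕ} {q : Equiv.Perm (Fin n)}
    (hq : ∀ i m : Fin n, (m : ℕ) = i + 1 → q m < q i → (q m : ℕ) + 1 = q i)
    {α : Type*} {t : Fin n → α}
    (ht : ∀ i m : Fin n, (m : ℕ) = i + 1 → q m < q i → t m = t i) (i : Fin n) :
    t (q i) = t i := by
  let t' : ℕ → Option α := Function.extend Fin.val (some ∘ t) fun _ => none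
  have ht' (i : Fin n) : t' i = some (t i) := Fin.val_injective.extend_apply _ _ i
  have h := (hasUnitDescents_extendDomain hq).apply_eq_of_descent (Equiv.bijective _) (t := t')
    (fun i hdesc => by
      obtain ⟨a, b, rfl, hb, hqba⟩ := exists_descent_of_extendDomain_lt q hdesc
      rw [← hb, ht', ht', ht a b hb hqba]) i
  rw [extendDomain_equivSubtype_apply, ht', ht'] at h
  exact Option.some_injective _ h

variable {k : Type v} [Field k] {n : ℕ} {K : Type w} [Field K] {ψ : AddChar k K}

lemma whittakerChar_antitranspose (u : unitriangular k n) :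
    whittakerChar ψ ⟨antitranspose u.val, antitranspose_mem_unitriangular u.2⟩ =
      whittakerChar ψ u :=
  congrArg ψ (superdiagSum_antitranspose u.val)

variable [Finite k] {V : Type u} [AddCommGroup V] [Module K V]
  {ρ : Representation K (GL (Fin n) k) V}

lemma eq_succ_of_heckeOp_ne_zero (hψ : ψ ≠ 1) {g : GL (Fin n) k} {i m a b : Fin n}
    (hi : IsPivot g i a) (hm : IsPivot g m b) (him : (m : ℕ) = i + 1) (hab : a < b)
    (hg : heckeOp ρ (whittakerChar ψ) g ≠ 0) : (b : ℕ) = a + 1 ∧ g.val i a = g.val m b := by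
  have him' : i ∈ Set.Iio m := Fin.lt_def.2 (by omega)
  have hab' : a ∈ Set.Iio b := hab
  let t := g.val i a / g.val m b
  have ht : t ≠ 0 := div_ne_zero hi.ne_zero hm.ne_zero
  have hshift : ψ.mulShift (if (b : ℕ) = a + 1 then 1 else 0) = ψ.mulShift t := by
    ext z
    have hrel := congrArg (heckeOp ρ (whittakerChar ψ))
      (hi.mul_columnUnipotent_single hm him' hab z)
    rw [heckeOp_mul_right g ⟨_, columnUnipotent_mem_unitriangular b _⟩,
      heckeOp_mul_left ⟨_, columnUnipotent_mem_unitriangular m _⟩ g] at hrel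
    have hchar : ψ (superdiagSum (columnUnipotent b (.ofAdd (Pi.single ⟨a, hab'⟩ z)))) =
        ψ (superdiagSum (columnUnipotent m (.ofAdd (Pi.single ⟨i, him'⟩ (t * z))))) :=
      smul_left_injective K hg hrel
    rwa [superdiagSum_columnUnipotent_single, superdiagSum_columnUnipotent_single, if_pos him,
      one_mul] at hchar
  have heq := AddChar.to_mulShift_inj_of_isPrimitive (AddChar.IsPrimitive.of_ne_one hψ) hshift
  split_ifs at heq with hb
  · exact ⟨hb, ((div_eq_one_iff_eq hm.ne_zero).1 heq.symm)⟩
  · exact absurd heq.symm ht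

lemma IsMonomial.antitranspose_eq (hψ : ψ ≠ 1) {g : GL (Fin n) k} (hg : IsMonomial g)
    (hne : heckeOp ρ (whittakerChar ψ) g ≠ 0) : TateGL.antitranspose g = g := by
  obtain ⟨p, hp⟩ := hg.exists_perm
  let q : Equiv.Perm (Fin n) := p.trans Fin.revPerm
  have hq_apply (i : Fin n) : q i = (p i).rev := rfl
  have hpivot (i : Fin n) : IsPivot g i (q i).rev := by
    rw [hq_apply, Fin.rev_rev]
    exact hp i
  have hdesc (i m : Fin n) (him : (m : ℕ) = i + 1) (hqm : q m < q i) :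
      (q m : ℕ) + 1 = q i ∧ g.val m (q m).rev = g.val i (q i).rev := by
    obtain ⟨hsucc, hval⟩ := eq_succ_of_heckeOp_ne_zero hψ (hpivot i) (hpivot m) him
      (Fin.rev_lt_rev.2 hqm) hne
    rw [Fin.val_rev, Fin.val_rev] at hsucc
    exact ⟨by omega, hval.symm⟩
  have hq : Function.Involutive q :=
    involutive_of_unit_descents fun i m him hqm => (hdesc i m him hqm).1
  have hval (i : Fin n) : g.val (q i) i.rev = g.val i (q i).rev := by
    have h := apply_eq_of_unit_descents (t := fun i => g.val i (q i).rev)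
      (fun i m him hqm => (hdesc i m him hqm).1) (fun i m him hqm => (hdesc i m him hqm).2) i
    rwa [hq] at h
  ext i j
  rw [antitranspose_apply]
  by_cases hj : j = (q i).rev
  · rw [hj, Fin.rev_rev, hval]
  · rw [(hpivot i).row j hj]
    refine (hpivot j.rev).row _ fun h => hj ?_
    rw [Fin.rev_inj.1 h, hq, Fin.rev_rev]

lemma heckeOp_antitranspose (hψ : ψ ≠ 1) (g : GL (Fin n) k) :
    heckeOp ρ (whittakerChar ψ) (antitranspose g) = heckeOp ρ (whittakerChar ψ) g := by
  obtain ⟨a, ha, b, hb, hab⟩ := exists_isMonomial_unitriangular_mul_mul g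
  have hmonomial : heckeOp ρ (whittakerChar ψ) (antitranspose (a * g * b)) =
      heckeOp ρ (whittakerChar ψ) (a * g * b) := by
    by_cases h : heckeOp ρ (whittakerChar ψ) (a * g * b) = 0
    · by_contra hne
      have hflip := hab.antitranspose.antitranspose_eq hψ fun h' => hne (h'.trans h.symm)
      rw [antitranspose_involutive] at hflip
      exact hne (by rw [← hflip])
    · rw [hab.antitranspose_eq hψ h]
  have hunit (u : unitriangular k n) : IsUnit (whittakerChar ψ u) := (Group.isUnit u).map _
  have hleft := heckeOp_mul_left (ρ := ρ) (χ := whittakerChar ψ)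
  have hright := heckeOp_mul_right (ρ := ρ) (χ := whittakerChar ψ)
  rw [antitranspose_mul, antitranspose_mul,
    hleft ⟨_, antitranspose_mem_unitriangular hb⟩, hright _ ⟨_, antitranspose_mem_unitriangular ha⟩,
    hright _ ⟨b, hb⟩, hleft ⟨a, ha⟩, whittakerChar_antitranspose ⟨a, ha⟩,
    whittakerChar_antitranspose ⟨b, hb⟩] at hmonomial
  exact (hunit ⟨a, ha⟩).smul_left_cancel.1 ((hunit ⟨b, hb⟩).smul_left_cancel.1 hmonomial)

theorem exists_smul_eq_of_mem_whittakerSpace [CharZero K] [IsAlgClosed K] [FiniteDimensional K V]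
    (hρ : ρ.IsIrreducible) (hψ : ψ ≠ 1) {x y : V} (hx₀ : x ≠ 0) (hx : x ∈ whittakerSpace ρ ψ 0)
    (hy : y ∈ whittakerSpace ρ ψ 0) : ∃ a : K, a • x = y :=
  exists_eq_smul_of_commute_heckeOp hρ
    (commute_heckeOp antitranspose_mul antitranspose_involutive
      (fun _ => antitranspose_mem_unitriangular) whittakerChar_antitranspose
      (heckeOp_antitranspose hψ)) hx₀ (mem_whittakerSpace_zero.1 hx) (mem_whittakerSpace_zero.1 hy)

end MultiplicityOne

section Existence

variable {k : Type v} [Field k] {n : ℕ}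

lemma map_mem_unitriangular (σ : k →+* k) {u : GL (Fin n) k} (hu : u ∈ unitriangular k n) :
    Matrix.GeneralLinearGroup.map σ u ∈ unitriangular k n := fun i j hij => by
  rw [Matrix.GeneralLinearGroup.map_apply, hu i j hij, Matrix.one_apply, apply_ite σ, map_one,
    map_zero]

lemma superdiagSum_map (σ : k →+* k) (g : GL (Fin n) k) :
    superdiagSum (Matrix.GeneralLinearGroup.map σ g) = σ (superdiagSum g) := by
  simp only [superdiagSum, map_sum, apply_ite σ, map_zero, Matrix.GeneralLinearGroup.map_apply]

variable {K : Type w} [Field K] {V : Type u} [AddCommGroup V] [Module K V] {l : ℕ} {σ : k ≃+* k}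
  {ρ : Representation K (GL (Fin n) k) V} {ψ : AddChar k K}

lemma apply_mem_whittakerSpace_zero_of_intertwines {T : Module.End K V}
    (hψσ : ∀ a, ψ (σ a) = ψ a)
    (hT : ∀ g x, T (ρ g x) = ρ (Matrix.GeneralLinearGroup.map (σ : k →+* k) g) (T x)) {x : V}
    (hx : x ∈ whittakerSpace ρ ψ 0) : T x ∈ whittakerSpace ρ ψ 0 := by
  rw [mem_whittakerSpace_zero] at hx ⊢
  rintro ⟨u, hu⟩
  let u' : unitriangular k n := ⟨_, map_mem_unitriangular (σ.symm : k →+* k) hu⟩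
  have hu' : Matrix.GeneralLinearGroup.map (σ : k →+* k) u'.val = u := by
    ext i j
    exact σ.apply_symm_apply _
  calc ρ u (T x) = T (ρ u'.val x) := by rw [hT, hu']
    _ = ψ (superdiagSum u'.val) • T x := by
        rw [← map_smul]
        exact congrArg T (hx u')
    _ = ψ (superdiagSum u) • T x := by
        rw [← hψσ, ← hu']
        exact congrArg (ψ · • T x) (superdiagSum_map (σ : k →+* k) u'.val).symm

variable [Finite k] [CharZero K] [IsAlgClosed K]

theorem IsCuspidal.exists_isNormalizedIntertwiner (hρ : IsCuspidal ρ) (hirr : ρ.IsIrreducible)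
    (hψ : ψ ≠ 1) (hψσ : ∀ a, ψ (σ a) = ψ a) (hσ : ∀ a, σ^[l] a = a)
    (e : ρ.Equiv (ρ.comp (Matrix.GeneralLinearGroup.map (σ : k →+* k)))) :
    ∃ T, IsNormalizedIntertwiner l σ ρ ψ T := by
  have := nontrivial_of_isIrreducible hirr
  have := finiteDimensional_of_isIrreducible hirr
  have he (g : GL (Fin n) k) (x : V) : e.toLinearMap (ρ g x) =
      ρ (Matrix.GeneralLinearGroup.map (σ : k →+* k) g) (e.toLinearMap x) :=
    LinearMap.congr_fun (e.isIntertwining' g) x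
  obtain ⟨x, hx, hx₀⟩ := hρ.exists_mem_whittakerSpace_ne_zero hψ
  obtain ⟨a, ha⟩ := exists_smul_eq_of_mem_whittakerSpace hirr hψ hx₀ hx
    (apply_mem_whittakerSpace_zero_of_intertwines hψσ he hx)
  have ha₀ : a ≠ 0 := by
    rintro rfl
    rw [zero_smul, eq_comm] at ha
    exact hx₀ ((map_eq_zero_iff e.toLinearMap e.toLinearEquiv.injective).1 ha)
  refine ⟨a⁻¹ • e.toLinearMap, hρ.isNormalizedIntertwiner_of_normalized hψ hσ
    (fun g y => ?_) fun y hy => ?_⟩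
  · rw [LinearMap.smul_apply, LinearMap.smul_apply, he, map_smul]
  · obtain ⟨b, rfl⟩ := exists_smul_eq_of_mem_whittakerSpace hirr hψ hx₀ hx hy
    rw [LinearMap.smul_apply, map_smul, ← ha, smul_comm b a, smul_smul, inv_mul_cancel₀ ha₀,
      one_smul]

end Existence

section Frobenius

variable {k' : Type*} [Field k'] {k : Type*} [Field k] [Algebra k' k] {K : Type*} [Field K]

/-- The character `ε ∘ Tr` of `k`, for a character `ε` of the smaller field `k'`. -/
def traceChar (k : Type*) [Field k] [Algebra k' k] (ε : AddChar k' K) : AddChar k K :=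
  ε.compAddMonoidHom (Algebra.trace k' k).toAddMonoidHom

lemma traceChar_ne_one [Finite k'] [FiniteDimensional k' k] {ε : AddChar k' K} (hε : ε ≠ 1) :
    traceChar k ε ≠ 1 := by
  refine fun h => hε (DFunLike.ext _ _ fun x => ?_)
  obtain ⟨y, rfl⟩ := Algebra.trace_surjective k' k x
  exact DFunLike.congr_fun h y

variable [Fintype k'] [FiniteDimensional k' k]

lemma frobenius_iterate_finrank (a : k) :
    (FiniteField.frobeniusAlgEquivOfAlgebraic k' k)^[Module.finrank k' k] a = a := by
  have := Module.finite_of_finite k' (M := k)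
  have := Fintype.ofFinite k
  rw [FiniteField.coe_frobeniusAlgEquivOfAlgebraic_iterate, ← Module.card_eq_pow_finrank]
  exact FiniteField.pow_card a

lemma traceChar_frobenius (ε : AddChar k' K) (a : k) :
    traceChar k ε (FiniteField.frobeniusAlgEquivOfAlgebraic k' k a) = traceChar k ε a :=
  congrArg ε (Algebra.trace_eq_of_algEquiv (FiniteField.frobeniusAlgEquivOfAlgebraic k' k) a)

variable {l : ℕ} [Fact l.Prime] {n : ℕ} {V : Type*} [AddCommGroup V] [Module (QlBar l) V]
  {ρ : Representation (QlBar l) (GL (Fin n) k) V} {ε : AddChar k' (QlBar l)}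

lemma isFrobOperator_iff {T : Module.End (QlBar l) V} : IsFrobOperator ρ ε T ↔
    IsNormalizedIntertwiner l (FiniteField.frobeniusAlgEquivOfAlgebraic k' k : k ≃+* k) ρ
      (traceChar k ε) T := by
  have hW (x : V) : x ∈ whittakerSpace ρ (traceChar k ε) 0 ↔ ∀ u, IsUnipotentUpper u →
      ρ u x = ε (Algebra.trace k' k (superdiagSum u)) • x :=
    forall_congr' fun u => imp_congr_left (by rw [tailUnitriangular_zero, mem_unitriangular])
  exact ⟨fun h => ⟨h.intertwines, h.pow_eq_one, fun x hx => h.normalized x ((hW x).1 hx)⟩,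
    fun h => ⟨h.intertwines, h.pow_eq_one, fun x hx => h.normalized x ((hW x).2 hx)⟩⟩

end Frobenius

section Integrality

lemma coprime_natCard {l : ℕ} {k : Type*} [Field k] [Finite k] (h : l.Coprime (ringChar k)) :
    l.Coprime (Nat.card k) := by
  have := Fintype.ofFinite k
  obtain ⟨m, -, hm⟩ := FiniteField.card k (ringChar k)
  rw [Nat.card_eq_fintype_card, hm]
  exact h.pow_right _

variable {l : ℕ} [Fact l.Prime]

lemma addChar_mem_ZlBar {A : Type*} [AddCommGroup A] [Finite A] (ψ : AddChar A (QlBar l)) (a : A) :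
    ψ a ∈ ZlBar l := by
  have hpow : ψ a ^ Nat.card A = 1 := by
    rw [← AddChar.map_nsmul_eq_pow, card_nsmul_eq_zero', AddChar.map_zero_eq_one]
  exact IsIntegral.of_pow Nat.card_pos (hpow ▸ isIntegral_one)

lemma inv_natCast_mem_ZlBar {m : ℕ} (hm : l.Coprime m) : (m : QlBar l)⁻¹ ∈ ZlBar l := by
  have hunit : IsUnit (m : ℤ_[l]) := by
    rw [PadicInt.isUnit_iff, PadicInt.norm_def, PadicInt.coe_natCast]
    exact Padic.norm_natCast_eq_one_iff.2 hm
  obtain ⟨v, hv⟩ := hunit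
  have hinv : (m : QlBar l)⁻¹ = algebraMap ℤ_[l] (QlBar l) (v⁻¹ : ℤ_[l]ˣ) := by
    refine inv_eq_of_mul_eq_one_right ?_
    rw [← map_natCast (algebraMap ℤ_[l] (QlBar l)), ← hv, ← map_mul, Units.mul_inv, map_one]
  exact hinv ▸ Subalgebra.algebraMap_mem _ _

lemma IsInvariantLattice.isTameSubmodule {k : Type*} [Field k] [Finite k] {n : ℕ}
    {V : Type*} [AddCommGroup V] [Module (QlBar l) V]
    {ρ : Representation (QlBar l) (GL (Fin n) k) V} {L : Submodule (ZlBar l) V}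
    (hL : IsInvariantLattice ρ L) (hchar : l.Coprime (ringChar k)) (ψ : AddChar k (QlBar l)) :
    IsTameSubmodule ρ ψ L where
  apply_mem := hL.stable
  smul_mem a _ hx := L.smul_mem ⟨ψ a, addChar_mem_ZlBar ψ a⟩ hx
  inv_card_smul_mem _ hx := L.smul_mem ⟨_, inv_natCast_mem_ZlBar (coprime_natCard hchar)⟩ hx

end Integrality

end TateGL

end

open TateGL in
theorem mainTheorem7_general {k : Type*} [Field k] [Finite k] {l : ℕ} (hl : l.Prime) {σ : k ≃+* k}
    (hσ : ∀ a, σ^[l] a = a) {K : Type*} [Field K] [CharZero K] [IsAlgClosed K] {n : ℕ}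
    {V : Type*} [AddCommGroup V] [Module K V] {ρ : Representation K (GL (Fin n) k) V}
    (hirr : ρ.IsIrreducible) (hcusp : IsCuspidal ρ)
    (hfix : Nonempty (ρ.Equiv (ρ.comp (Matrix.GeneralLinearGroup.map (σ : k →+* k)))))
    {ψ : AddChar k K} (hψ : ψ ≠ 1) (hψσ : ∀ a, ψ (σ a) = ψ a) :
    (∃! T, IsNormalizedIntertwiner l σ ρ ψ T) ∧
    ∀ T, IsNormalizedIntertwiner l σ ρ ψ T →
      ∀ {R : Type*} [CommRing R] [Algebra R K] [Module R V] [IsScalarTower R K V]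
        (L : Submodule R V), IsTameSubmodule ρ ψ L →
        ∃ hT : ∀ x ∈ L, T.restrictScalars R x ∈ L,
          Subsingleton (TateH1 l ((T.restrictScalars R).restrict hT)) := by
  obtain ⟨e⟩ := hfix
  refine ⟨existsUnique_of_exists_of_unique
    (hcusp.exists_isNormalizedIntertwiner hirr hψ hψσ hσ e)
    fun T T' hT hT' => hcusp.isNormalizedIntertwiner_unique hψ hT hT', ?_⟩
  intro T hT R _ _ _ _ L hL
  exact ⟨fun x hx => hT.apply_mem hcusp hψ hL hx, subsingleton_tateH1_restrict _ fun x hx hnorm =>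
    hT.mem_map_one_sub hl hcusp hψ hψσ hσ hL n hx ((whittakerSpace_eq_top n.le_succ).ge trivial)
      hnorm⟩

theorem mainTheorem7 {l : ℕ} [Fact l.Prime]
    {k' : Type*} [Field k'] [Fintype k'] {k : Type*} [Field k] [Algebra k' k]
    (hdeg : Module.finrank k' k = l) (hchar : l.Coprime (ringChar k))
    {n : ℕ} (hn : 2 ≤ n)
    {V : Type*} [AddCommGroup V] [Module (TateGL.QlBar l) V]
    (ρ : Representation (TateGL.QlBar l) (GL (Fin n) k) V)
    (hirr : ρ.IsIrreducible) (hcusp : TateGL.IsCuspidal ρ)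
    (hint : TateGL.IsIntegralRep ρ) (hfix : TateGL.IsFrobFixed k' ρ)
    (ε : AddChar k' (TateGL.QlBar l)) (hε : ε ≠ 1) :
    (∃! T : Module.End (TateGL.QlBar l) V, TateGL.IsFrobOperator ρ ε T) ∧
    ∀ T : Module.End (TateGL.QlBar l) V, TateGL.IsFrobOperator ρ ε T →
      ∀ L : Submodule (TateGL.ZlBar l) V, TateGL.IsInvariantLattice ρ L →
        ∃ hT : ∀ x ∈ L, T.restrictScalars (TateGL.ZlBar l) x ∈ L,
          Subsingleton (TateGL.TateH1 l ((T.restrictScalars (TateGL.ZlBar l)).restrict hT)) := by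
  have hl : l.Prime := Fact.out
  have : FiniteDimensional k' k := Module.finite_of_finrank_pos (hdeg ▸ hl.pos)
  have : Finite k := Module.finite_of_finite k'
  obtain ⟨hunique, htate⟩ := mainTheorem7_general hl
    (σ := (FiniteField.frobeniusAlgEquivOfAlgebraic k' k : k ≃+* k))
    (hdeg ▸ TateGL.frobenius_iterate_finrank) hirr hcusp hfix (TateGL.traceChar_ne_one hε)
    (TateGL.traceChar_frobenius ε)
  simp only [TateGL.isFrobOperator_iff]
  exact ⟨hunique, fun T hT L hL => htate T hT L (hL.isTameSubmodule hchar _)⟩
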